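/- **Theorem (Distributed ETC with Exponential Performance).** Let $\mathcal G$ be a connected undirected graph on the agents $\{1,\dots,N\}$ with Laplacian $\mathbf L$. The network state is $x=(x_1,\dots,x_N)$ with $x_i\in\mathbb R^{n_i}$, and $n=\sum_i n_i$. Let $F:\mathbb R^n\times\mathbb R^m\to\mathbb R^n$ and $\kappa:\mathbb R^n\to\mathbb R^m$ be globally Lipschitz and put $f(x,e)=F(x,\kappa(x+e))$. Let $V=\sum_{i=1}^N V_i$, where each $V_i:\mathbb R^n\to\mathbb R$ depends only on the states of agent $i$ and of its neighbors, is continuously differentiable with globally Lipschitz gradient, and satisfies $\nabla V_i(0)=0$. Assume that there are positive constants $c_1,c_2,c_3,c_4$ such that, for all $x$, $$c_1\|x\|^2\le V(x)\le c_2\|x\|^2,\qquad \nabla V(x)\cdot f(x,0)\le -c_3\|x\|^2,\qquad \|\nabla V(x)\|\le c_4\|x\|.$$ (a) There are positive constants $L_f,c_\alpha,c_\gamma$ such that, for all $x,e,x',e'$, $$\|f(x,e)-f(x',e')\|\le L_f(\|x-x'\|+\|e-e'\|),\qquad \nabla V(x)\cdot f(x,e)\le -c_\alpha\|x\|^2+c_\gamma\|e\|^2.\tag{1}$$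 (b) Fix any positive constants $L_f,c_\alpha,c_\gamma$ that satisfy (1), and let $$0<r<\frac{c_\alpha}{c_2},\qquad 0<\sigma<1-\frac{rc_2}{c_\alpha},\qquad c_\beta>(1-\sigma)\frac{c_\alpha}{c_1}-r,$$ $$\tau^{d}_\sigma=\frac{q}{L_f+L_fq},\qquad q=\sqrt{\frac{(1-\sigma)c_\alpha-rc_2}{c_\gamma}} .$$ Then $\tau^d_\sigma>0$. Let $W^x(x)$ and $W^{xe}(x,e)$ be the vectors in $\mathbb R^N$ with components $$W^x_i=(\sigma-1)c_\alpha\|x_i\|^2+(r+c_\beta)V_i(x),\qquad W^{xe}_i=W^x_i+c_\gamma\|e_i\|^2 .$$ For gains $\rho_a,\rho_z>0$ and an initial state $x_0$, an *execution* of the distributed trigger consists of update times $0=t_0\le t_1\le\cdots$ in $[0,\infty]$, a state $x$ and estimates $a,z\in\mathbb R^N$, where $x$ and $z$ are continuous, $x(0)=x_0$, every entry of $z(0)$ equals $\frac1N\sum_jW^x_j(x_0)$, and between $t_k$ and $t_{k+1}$ $$\dot x=f(x,e),\quad e=x(t_k)-x,\qquad \dot z=\dot W^x-\rho_z\mathbf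 Lz,\qquad \dot a=\dot W^{xe}-\rho_a\mathbf La,$$ where $\dot W^x,\dot W^{xe}$ are the time derivatives along the execution. At each $t_k$ (including $t_0=0$) the estimate $a$ is reset by $a^+=z$, and $$t_{k+1}=\min\Big\{t\ge t_k:\ \exists i,\ a_i(t)=\tfrac{1}{N}c_\beta V(x_0)e^{-rt}\Big\},$$ with $t_{k+1}=\infty$ if this set is empty (and no further updates after that). An execution is defined for the times that lie in one of the intervals $[t_k,t_{k+1}]$. Then there are $\rho_a^*,\rho_z^*>0$, independent of $x_0$, such that for all $\rho_a\ge\rho_a^*$ and $\rho_z\ge\rho_z^*$: 1. an execution exists from every $x_0$; 2. for every $x_0\ne0$ and every execution from $x_0$, $t_{k+1}\ge t_k+\tau^d_\sigma$ for all $k\ge 0$ (so there is no Zeno behavior, and the execution is defined for all $t\ge0$), and $V(x(t))\le V(x_0)e^{-rt}$ for all $t\ge0$; 3. the origin is globally exponentially stable: $f(0,0)=0$, and there are $C,\lambda>0$ such that every execution, from every $x_0$, satisfies $\|x(t)\|\le C\|x_0\|e^{-\lambda t}$ at all times $t$ at which it is defined. -/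

import Mathlib

namespace DistributedETC

/-- The network state `x = (x_1, …, x_N)`, where agent `i` has state `x_i ∈ ℝ^{d i}`;
the norm is the Euclidean one, so `‖x‖² = ∑ i, ‖x_i‖²`. -/
abbrev NetState {N : ℕ} (d : Fin N → ℕ) : Type :=
  PiLp 2 (fun i => EuclideanSpace ℝ (Fin (d i)))

/-- The input space `ℝ^m`. -/
abbrev Input (m : ℕ) : Type := EuclideanSpace ℝ (Fin m)

variable {N m : ℕ} {d : Fin N → ℕ}

/-- The sample-and-hold dynamics `f(x, e) = F(x, κ(x + e))`, where `e = x_k - x`. -/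
def closedLoop (F : NetState d → Input m → NetState d) (κ : NetState d → Input m)
    (x e : NetState d) : NetState d :=
  F x (κ (x + e))

/-- The aggregate function `V(x) = ∑ i, V_i(x)`. -/
def aggregate (V : Fin N → NetState d → ℝ) (x : NetState d) : ℝ := ∑ i, V i x

/-- `h` depends only on the states of agent `i` and of its neighbors in `G`. -/
def IsLocalAt (G : SimpleGraph (Fin N)) (i : Fin N) (h : NetState d → ℝ) : Prop :=
  ∀ x y : NetState d, (∀ j, j = i ∨ G.Adj i j → x j = y j) → h x = h y

/-- `V` is an exponential-type Lyapunov function of `f` with constants `c₁, c₂, c₃, c₄`. -/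
structure IsExpLyapunov (f : NetState d → NetState d → NetState d) (V : NetState d → ℝ)
    (c₁ c₂ c₃ c₄ : ℝ) : Prop where
  pos₁ : 0 < c₁
  pos₂ : 0 < c₂
  pos₃ : 0 < c₃
  pos₄ : 0 < c₄
  lower : ∀ x, c₁ * ‖x‖ ^ 2 ≤ V x
  upper : ∀ x, V x ≤ c₂ * ‖x‖ ^ 2
  decay : ∀ x, fderiv ℝ V x (f x 0) ≤ -c₃ * ‖x‖ ^ 2
  grad : ∀ x, ‖fderiv ℝ V x‖ ≤ c₄ * ‖x‖

/-- `L_f` is a Lipschitz constant of `f` with respect to `(x, e)`, and `c_α, c_γ` are constants in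
the dissipation inequality `L_f V(x, e) ≤ -c_α ‖x‖² + c_γ ‖e‖²`; all of them are positive.
A Lipschitz constant with respect to the Euclidean norm of the pair `(x, e)` satisfies
`lipschitz`. -/
structure AreRateConstants (f : NetState d → NetState d → NetState d) (V : NetState d → ℝ)
    (Lf cα cγ : ℝ) : Prop where
  pos_L : 0 < Lf
  pos_α : 0 < cα
  pos_γ : 0 < cγ
  lipschitz : ∀ x e x' e', ‖f x e - f x' e'‖ ≤ Lf * (‖x - x'‖ + ‖e - e'‖)
  dissipation : ∀ x e, fderiv ℝ V x (f x e) ≤ -cα * ‖x‖ ^ 2 + cγ * ‖e‖ ^ 2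

/-- The time `τᵈ_σ` at which `φ(τ) = L_f τ / (1 - L_f τ)` satisfies
`((σ - 1) c_α + c_γ φ(τ)²) / c₂ = -r`. -/
noncomputable def tauD (Lf cα cγ c₂ σ r : ℝ) : ℝ :=
  √(((1 - σ) * cα - r * c₂) / cγ) / (Lf + Lf * √(((1 - σ) * cα - r * c₂) / cγ))

/-- The vector `W^x(x)`, with components `(σ - 1) c_α ‖x_i‖² + (r + c_β) V_i(x)`. -/
noncomputable def Wx (V : Fin N → NetState d → ℝ) (cα σ r cβ : ℝ)
    (x : NetState d) : Fin N → ℝ :=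
  fun i => (σ - 1) * cα * ‖x i‖ ^ 2 + (r + cβ) * V i x

/-- The vector `W^{xe}(x, e)`, with components `W^x_i(x) + c_γ ‖e_i‖²`. -/
noncomputable def Wxe (V : Fin N → NetState d → ℝ) (cα cγ σ r cβ : ℝ)
    (x e : NetState d) : Fin N → ℝ :=
  fun i => Wx V cα σ r cβ x i + cγ * ‖e i‖ ^ 2

/-- The closed time interval `[t_k, t_{k+1}]`, which is `[t_k, ∞)` if `t_{k+1} = ∞` and is
empty if `t_k = ∞`. -/
def timeInterval (t : ℕ → EReal) (k : ℕ) : Set ℝ :=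
  {s | t k ≤ (s : EReal) ∧ (s : EReal) ≤ t (k + 1)}

/-- An execution, from `x₀`, of the sample-and-hold system under the distributed trigger.

`t k` is the `k`-th update time (`⊤` if fewer than `k` updates occur after time `0`), `x` is the
state, `z` the estimate of the average of `W^x`, and `a k` the estimate of the average of
`W^{xe}` between `t_k` (after the jump) and `t_{k+1}` (before the jump). Derivatives at the ends
of `[t_k, t_{k+1}]` are one-sided. Nothing is required outside the union of these intervals. -/
structure Execution (G : SimpleGraph (Fin N)) [DecidableRel G.Adj]
    (F : NetState d → Input m → NetState d) (κ : NetState d → Input m)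
    (V : Fin N → NetState d → ℝ) (cα cγ σ r cβ ρa ρz : ℝ) (x₀ : NetState d) where
  t : ℕ → EReal
  x : ℝ → NetState d
  z : ℝ → Fin N → ℝ
  a : ℕ → ℝ → Fin N → ℝ
  t_zero : t 0 = 0
  t_mono : Monotone t
  x_zero : x 0 = x₀
  /-- `ẋ = f(x, e)` with `e = x(t_k) - x`. -/
  x_ode : ∀ k, ∀ s ∈ timeInterval t k,
    HasDerivWithinAt x (closedLoop F κ (x s) (x (t k).toReal - x s)) (timeInterval t k) s
  z_zero : ∀ i, z 0 i = (∑ j, Wx V cα σ r cβ x₀ j) / N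
  /-- `ż = Ẇ^x - ρ_z L z`. -/
  z_ode : ∀ k, ∀ s ∈ timeInterval t k,
    HasDerivWithinAt z
      (derivWithin (fun τ => Wx V cα σ r cβ (x τ)) (timeInterval t k) s
        - ρz • (G.lapMatrix ℝ).mulVec (z s))
      (timeInterval t k) s
  /-- The jump `a⁺ = z` at `t_k`. For `k = 0` it is the initialization of `a`. -/
  a_jump : ∀ k, ∀ s : ℝ, (s : EReal) = t k → a k s = z s
  /-- `ȧ = Ẇ^{xe} - ρ_a L a`. -/
  a_ode : ∀ k, ∀ s ∈ timeInterval t k,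
    HasDerivWithinAt (a k)
      (derivWithin (fun τ => Wxe V cα cγ σ r cβ (x τ) (x (t k).toReal - x τ))
          (timeInterval t k) s
        - ρa • (G.lapMatrix ℝ).mulVec (a k s))
      (timeInterval t k) s
  /-- `t_{k+1}` is the least `s ≥ t_k` such that `a_i(s) = c_β V(x₀) exp(-r s) / N` for some `i`,
  and is `∞` if there is none: the condition fails on `[t_k, t_{k+1})`, … -/
  no_trigger_before : ∀ k, ∀ s : ℝ, t k ≤ (s : EReal) → (s : EReal) < t (k + 1) →
    ∀ i, a k s i ≠ cβ * aggregate V x₀ * Real.exp (-r * s) / N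
  /-- … and it holds at `t_{k+1}` if this is finite. -/
  trigger_at : ∀ k, ∀ s : ℝ, (s : EReal) = t (k + 1) →
    ∃ i, a k s i = cβ * aggregate V x₀ * Real.exp (-r * s) / N

/-- The origin is globally exponentially stable under the distributed trigger: it is an
equilibrium, and all executions satisfy a common exponential bound while they are defined. -/
def GloballyExpStable (G : SimpleGraph (Fin N)) [DecidableRel G.Adj]
    (F : NetState d → Input m → NetState d) (κ : NetState d → Input m)
    (V : Fin N → NetState d → ℝ) (cα cγ σ r cβ ρa ρz : ℝ) : Prop :=
  closedLoop F κ 0 0 = 0 ∧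
    ∃ C lam : ℝ, 0 < C ∧ 0 < lam ∧
      ∀ (x₀ : NetState d) (E : Execution G F κ V cα cγ σ r cβ ρa ρz x₀) (k : ℕ),
        ∀ s ∈ timeInterval E.t k, ‖E.x s‖ ≤ C * ‖x₀‖ * Real.exp (-lam * s)

end DistributedETC

/-!
On a time interval after an update, the sum of the entries of `a` equals the sum of the entries of
`W^{xe}(x, e)`, since the Laplacian does not change sums. The trigger keeps all entries of `a`
below their threshold, hence `(σ - 1) c_α ‖x‖² + (r + c_β) V(x) + c_γ ‖e‖² ≤ c_β V(x₀) e^{-rt}`.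
With the dissipation inequality this gives `V̇ ≤ -(r + c_β) V + c_β V(x₀) e^{-rt}`, and therefore
`V ≤ V(x₀) e^{-rt}`.

For the time `τᵈ_σ` after an update, the left-hand side even stays below
`(c_β - μ) V(x₀) e^{-rt}` with a constant `μ > 0`: the sampling error is small compared to `x` at
first, and later `V` has gained on `e^{-rt}` because it decays at a faster rate than `r`.
An entry of `a` reaches its threshold only if it deviates from the average of the entries by at
least `μ V(x₀) e^{-rt} / N`. The derivatives of `W^x` and `W^{xe}` are bounded by a multiple of
`‖x‖² + ‖e‖²`, hence of `V(x₀) e^{-rt}`, so high consensus gains keep the deviations of `z` and `a`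
below half of this value. All these bounds are relative to `V(x₀) e^{-rt}`, which is why the gains
do not depend on `x₀`.
-/

namespace DistributedETC

open Filter Function Matrix Real Set Topology Asymptotics
open scoped NNReal BigOperators

section ODE

variable {E : Type*} [NormedAddCommGroup E] [NormedSpace ℝ E]

theorem hasDerivWithinAt_Ioi_of_Icc {y : ℝ → E} {y' : E} {a b s : ℝ} (hs : s ∈ Ico a b)
    (h : HasDerivWithinAt y y' (Icc a b) s) : HasDerivWithinAt y y' (Ioi s) s :=
  h.mono_of_mem_nhdsWithin <| mem_of_superset (Ioc_mem_nhdsGT hs.2) fun _ hu =>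
    ⟨hs.1.trans hu.1.le, hu.2⟩

theorem hasDerivWithinAt_Icc_of_left {y : ℝ → E} {y' : E} {a b c s : ℝ}
    (h : HasDerivWithinAt y y' (Icc a b) s) (hs : s < b) : HasDerivWithinAt y y' (Icc a c) s := by
  refine h.mono_of_mem_nhdsWithin ?_
  filter_upwards [self_mem_nhdsWithin, mem_nhdsWithin_of_mem_nhds (Iio_mem_nhds hs)] with u h₁ h₂
  exact ⟨h₁.1, le_of_lt h₂⟩

theorem hasDerivWithinAt_Icc_of_right {y : ℝ → E} {y' : E} {a b c s : ℝ}
    (h : HasDerivWithinAt y y' (Icc b c) s) (hs : b < s) : HasDerivWithinAt y y' (Icc a c) s := by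
  refine h.mono_of_mem_nhdsWithin ?_
  filter_upwards [self_mem_nhdsWithin, mem_nhdsWithin_of_mem_nhds (Ioi_mem_nhds hs)] with u h₁ h₂
  exact ⟨le_of_lt h₂, h₁.2⟩

theorem isIntegralCurveOn_Icc_union {v : ℝ → E → E} {y : ℝ → E} {a b c : ℝ} (hab : a ≤ b)
    (hbc : b ≤ c) (h₁ : IsIntegralCurveOn y v (Icc a b)) (h₂ : IsIntegralCurveOn y v (Icc b c)) :
    IsIntegralCurveOn y v (Icc a c) := fun s hs => by
  rcases lt_trichotomy s b with hsb | rfl | hsb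
  · exact hasDerivWithinAt_Icc_of_left (h₁ s ⟨hs.1, hsb.le⟩) hsb
  · rw [← Icc_union_Icc_eq_Icc hab hbc]
    exact (h₁ s ⟨hs.1, le_rfl⟩).union (h₂ s ⟨le_rfl, hs.2⟩)
  · exact hasDerivWithinAt_Icc_of_right (h₂ s ⟨hsb.le, hs.2⟩) hsb

theorem isIntegralCurveOn_congr {v : ℝ → E → E} {y w : ℝ → E} {S : Set ℝ}
    (h : IsIntegralCurveOn y v S) (hw : EqOn w y S) : IsIntegralCurveOn w v S := fun s hs => by
  rw [hw hs]
  exact (h s hs).congr hw (hw hs)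

theorem exists_isIntegralCurveOn_Icc_union {v : ℝ → E → E} {y w : ℝ → E} {a b c : ℝ}
    (hab : a ≤ b) (hbc : b ≤ c) (hy : IsIntegralCurveOn y v (Icc a b))
    (hw : IsIntegralCurveOn w v (Icc b c)) (hyw : w b = y b) :
    ∃ u, u a = y a ∧ IsIntegralCurveOn u v (Icc a c) := by
  classical
  have hu₁ : EqOn ((Iic b).piecewise y w) y (Icc a b) := fun s hs => piecewise_eq_of_mem _ _ _ hs.2
  have hu₂ : EqOn ((Iic b).piecewise y w) w (Icc b c) := fun s hs => by
    rcases hs.1.eq_or_lt with rfl | h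
    · rw [piecewise_eq_of_mem _ _ _ (mem_Iic.2 le_rfl), hyw]
    · exact piecewise_eq_of_notMem _ _ _ (not_le.2 h)
  exact ⟨_, hu₁ ⟨le_rfl, hab⟩, isIntegralCurveOn_Icc_union hab hbc
    (isIntegralCurveOn_congr hy hu₁) (isIntegralCurveOn_congr hw hu₂)⟩

theorem eqOn_Icc_of_isIntegralCurveOn {v : ℝ → E → E} {K : ℝ≥0} (hv : ∀ t, LipschitzWith K (v t))
    {y w : ℝ → E} {a b : ℝ} (hy : IsIntegralCurveOn y v (Icc a b))
    (hw : IsIntegralCurveOn w v (Icc a b)) (ha : y a = w a) : EqOn y w (Icc a b) := by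
  have right {u : ℝ → E} (hu : IsIntegralCurveOn u v (Icc a b)) :
      ∀ s ∈ Ico a b, HasDerivWithinAt u (v s (u s)) (Ici s) s := fun s hs =>
    (hasDerivWithinAt_Ioi_of_Icc hs (hu s (Ico_subset_Icc_self hs))).Ici_of_Ioi
  exact ODE_solution_unique_of_mem_Icc_right (s := fun _ => univ)
    (fun t _ => (hv t).lipschitzOnWith) hy.continuousOn (right hy) (fun _ _ => mem_univ _)
    hw.continuousOn (right hw) (fun _ _ => mem_univ _) ha

variable [CompleteSpace E] {v : ℝ → E → E} {K : ℝ≥0}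

theorem exists_isIntegralCurveOn_Icc_of_lipschitz (hv : ∀ t, LipschitzWith K (v t))
    (hc : ∀ y, Continuous fun t => v t y) (b : ℝ) (y₀ : E) :
    ∃ y : ℝ → E, y b = y₀ ∧ IsIntegralCurveOn y v (Icc b (b + (2 * K + 1 : ℝ)⁻¹)) := by
  set h : ℝ := (2 * K + 1 : ℝ)⁻¹
  have hpos : 0 < h := by positivity
  obtain ⟨M, hM⟩ := (isCompact_Icc (a := b) (b := b + h)).exists_bound_of_continuousOn
    (hc y₀).continuousOn
  have hM0 : 0 ≤ M := (norm_nonneg _).trans (hM b ⟨le_rfl, by linarith⟩)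
  have hKh : (K : ℝ) * h ≤ 1 / 2 := by
    have : (2 * K + 1 : ℝ) * h = 1 := mul_inv_cancel₀ (by positivity)
    nlinarith
  -- In the ball of radius `2hM` the speed is at most `M + 2KhM ≤ 2M`.
  have picard : IsPicardLindelof v (⟨b, le_rfl, by linarith⟩ : Icc b (b + h)) y₀
      (⟨2 * h * M, by positivity⟩ : ℝ≥0) 0 (⟨M + K * (2 * h * M), by positivity⟩ : ℝ≥0) K := by
    refine ⟨fun t _ => (hv t).lipschitzOnWith, fun y _ => (hc y).continuousOn, ?_, ?_⟩
    · intro t ht y hy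
      calc ‖v t y‖ ≤ ‖v t y₀‖ + ‖v t y - v t y₀‖ := norm_le_norm_add_norm_sub' _ _
        _ ≤ M + K * ‖y - y₀‖ := by
            gcongr
            · exact hM t ht
            · simpa [dist_eq_norm] using (hv t).dist_le_mul y y₀
        _ ≤ M + K * (2 * h * M) := by gcongr; exact mem_closedBall_iff_norm.1 hy
    · change (M + K * (2 * h * M)) * max (b + h - b) (b - b) ≤ 2 * h * M - 0
      rw [add_sub_cancel_left, sub_self, max_eq_left hpos.le]
      have : 0 ≤ M * h := by positivity
      nlinarith
  exact picard.exists_eq_forall_mem_Icc_hasDerivWithinAt₀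

theorem exists_isIntegralCurveOn_Icc_nat_mul_of_lipschitz (hv : ∀ t, LipschitzWith K (v t))
    (hc : ∀ y, Continuous fun t => v t y) (a : ℝ) (y₀ : E) (n : ℕ) :
    ∃ y : ℝ → E, y a = y₀ ∧ IsIntegralCurveOn y v (Icc a (a + n * (2 * K + 1 : ℝ)⁻¹)) := by
  have hpos : 0 < (2 * K + 1 : ℝ)⁻¹ := by positivity
  induction n with
  | zero =>
    refine ⟨fun _ => y₀, rfl, ?_⟩
    simp only [CharP.cast_eq_zero, zero_mul, add_zero, Icc_self]
    exact fun s _ => HasFDerivWithinAt.of_subsingleton subsingleton_singleton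
  | succ n ih =>
    obtain ⟨y, hya, hy⟩ := ih
    obtain ⟨w, hwb, hw⟩ := exists_isIntegralCurveOn_Icc_of_lipschitz hv hc
      (a + n * (2 * K + 1 : ℝ)⁻¹) (y (a + n * (2 * K + 1 : ℝ)⁻¹))
    obtain ⟨u, hua, hu⟩ := exists_isIntegralCurveOn_Icc_union
      (le_add_of_nonneg_right (by positivity)) (le_add_of_nonneg_right hpos.le) hy hw hwb
    exact ⟨u, hua.trans hya, by convert hu using 2; push_cast; ring⟩

theorem exists_isIntegralCurveOn_Ici_of_lipschitz (hv : ∀ t, LipschitzWith K (v t))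
    (hc : ∀ y, Continuous fun t => v t y) (a : ℝ) (y₀ : E) :
    ∃ y : ℝ → E, y a = y₀ ∧ IsIntegralCurveOn y v (Ici a) := by
  choose Y hYa hY using exists_isIntegralCurveOn_Icc_nat_mul_of_lipschitz hv hc a y₀
  set h : ℝ := (2 * K + 1 : ℝ)⁻¹
  have hpos : 0 < h := by positivity
  have agree {k n : ℕ} (hkn : k ≤ n) : EqOn (Y k) (Y n) (Icc a (a + k * h)) :=
    eqOn_Icc_of_isIntegralCurveOn hv (hY k) ((hY n).mono (Icc_subset_Icc_right (by gcongr)))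
      ((hYa k).trans (hYa n).symm)
  let index (s : ℝ) : ℕ := ⌊(s - a) / h⌋₊ + 1
  have lt_index (s : ℝ) : s < a + index s * h := by
    have := Nat.lt_floor_add_one ((s - a) / h)
    rw [div_lt_iff₀ hpos] at this
    simp only [index, Nat.cast_add, Nat.cast_one]
    linarith
  have glue (n : ℕ) : EqOn (fun s => Y (index s) s) (Y n) (Icc a (a + n * h)) := fun s hs => by
    rcases le_total (index s) n with hn | hn
    · exact agree hn ⟨hs.1, (lt_index s).le⟩
    · exact (agree hn hs).symm
  refine ⟨fun s => Y (index s) s, hYa (index a), fun s hs => ?_⟩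
  have hsI := isIntegralCurveOn_congr (hY (index s)) (glue (index s)) s ⟨hs, (lt_index s).le⟩
  refine hsI.mono_of_mem_nhdsWithin ?_
  filter_upwards [self_mem_nhdsWithin, mem_nhdsWithin_of_mem_nhds (Iio_mem_nhds (lt_index s))]
    with u h₁ h₂
  exact ⟨h₁, le_of_lt h₂⟩

end ODE

section Comparison

theorem le_mul_exp_of_deriv_le {u u' : ℝ → ℝ} {a b c k : ℝ}
    (hu : ∀ s ∈ Icc a b, HasDerivWithinAt u (u' s) (Icc a b) s) (ha : u a ≤ c)
    (hle : ∀ s ∈ Icc a b, u' s ≤ k * u s) : ∀ s ∈ Icc a b, u s ≤ c * exp (k * (s - a)) := by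
  intro s hs
  rw [← gronwallBound_ε0]
  refine le_gronwallBound_of_liminf_deriv_right_le (f' := u')
    (fun s hs => (hu s hs).continuousWithinAt) (fun s hs ρ hρ => ?_) ha (fun s hs => ?_) s hs
  · exact (hasDerivWithinAt_Ioi_of_Icc hs (hu s (Ico_subset_Icc_self hs))).Ici_of_Ioi
      |>.liminf_right_slope_le hρ
  · simpa using hle s (Ico_subset_Icc_self hs)

theorem le_mul_exp_neg_of_deriv_le {u u' : ℝ → ℝ} {a b c k r : ℝ}
    (hu : ∀ s ∈ Icc a b, HasDerivWithinAt u (u' s) (Icc a b) s) (ha : u a ≤ c * exp (-r * a))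
    (hle : ∀ s ∈ Icc a b, u' s ≤ -k * u s + (k - r) * (c * exp (-r * s))) :
    ∀ s ∈ Icc a b, u s ≤ c * exp (-r * s) := by
  have hexp (s : ℝ) : HasDerivAt (fun s => c * exp (-r * s)) (-r * (c * exp (-r * s))) s := by
    simpa [mul_comm, mul_left_comm] using ((hasDerivAt_id s).const_mul (-r)).exp.const_mul c
  intro s hs
  have := le_mul_exp_of_deriv_le (c := 0) (k := -k)
    (fun s hs => (hu s hs).fun_sub (hexp s).hasDerivWithinAt) (sub_nonpos.2 ha)
    (fun s hs => by linarith [hle s hs]) s hs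
  rwa [zero_mul, sub_nonpos] at this

theorem norm_sub_le_of_norm_deriv_le {E : Type*} [NormedAddCommGroup E] [NormedSpace ℝ E]
    {x x' : ℝ → E} {a b L : ℝ} (hL : 0 ≤ L) (hb : L * (b - a) ≤ 1)
    (hx : ∀ s ∈ Icc a b, HasDerivWithinAt x (x' s) (Icc a b) s)
    (hle : ∀ s ∈ Icc a b, ‖x' s‖ ≤ L * (‖x s‖ + ‖x a - x s‖)) :
    ∀ s ∈ Icc a b, ‖x a - x s‖ ≤ L * (s - a) * (‖x s‖ + ‖x a - x s‖) := by
  have hxc : ContinuousOn x (Icc a b) := fun s hs => (hx s hs).continuousWithinAt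
  refine fun s hs => sub_nonpos.1 <| image_le_of_liminf_slope_right_le_deriv_boundary
    (f := fun s => ‖x a - x s‖ - L * (s - a) * (‖x s‖ + ‖x a - x s‖)) (B := fun _ => 0)
    (B' := fun _ => 0) (by fun_prop) (by simp) continuousOn_const
    (fun s _ => hasDerivWithinAt_const _ _ _) (fun s hs ρ hρ => Eventually.frequently ?_) hs
  have slope_le := (hasDerivWithinAt_Ioi_of_Icc hs (hx s (Ico_subset_Icc_self hs)))
    |>.limsup_norm_slope_le (r := L * (‖x s‖ + ‖x a - x s‖) + ρ)
      (by linarith [hle s (Ico_subset_Icc_self hs)])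
  filter_upwards [slope_le, Ioc_mem_nhdsGT hs.2] with u hu hub
  have hpos : 0 < u - s := sub_pos.2 hub.1
  rw [slope_def_field, div_lt_iff₀ hpos]
  rw [norm_eq_abs, abs_of_pos hpos, inv_mul_lt_iff₀ hpos] at hu
  have error_sub_le : ‖x a - x u‖ - ‖x a - x s‖ ≤ ‖x u - x s‖ := by
    simpa [norm_sub_rev] using norm_sub_norm_le (x a - x u) (x a - x s)
  have state_sub_le : ‖x s‖ - ‖x u‖ ≤ ‖x u - x s‖ := by
    simpa only [norm_sub_rev] using norm_sub_norm_le (x s) (x u)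
  have weight_nonneg : 0 ≤ L * (u - a) := mul_nonneg hL (by linarith [hub.1, hs.1])
  have weight_le : 0 ≤ 1 - L * (u - a) := by nlinarith [hub.2]
  nlinarith [mul_le_mul_of_nonneg_left error_sub_le weight_le,
    mul_le_mul_of_nonneg_left state_sub_le weight_nonneg]

theorem le_of_continuousOn_of_ne {u v : ℝ → ℝ} {a b : ℝ} (hu : ContinuousOn u (Icc a b))
    (hv : ContinuousOn v (Icc a b)) (ha : u a < v a) (hne : ∀ s ∈ Ico a b, u s ≠ v s) :
    ∀ s ∈ Icc a b, u s ≤ v s := by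
  intro s hs
  by_contra! hlt
  obtain ⟨p, hp, hpeq⟩ := intermediate_value_Icc hs.1
    ((hu.sub hv).mono (Icc_subset_Icc_right hs.2)) ⟨(sub_neg.2 ha).le, (sub_pos.2 hlt).le⟩
  have hps : p ≠ s := fun h => hlt.ne' (by rw [← h]; exact sub_eq_zero.1 hpeq)
  exact hne p ⟨hp.1, (lt_of_le_of_ne hp.2 hps).trans_le hs.2⟩ (sub_eq_zero.1 hpeq)

end Comparison

section Consensus

variable {ι : Type*} [Fintype ι]

/-- The sum of the squared deviations of the entries of `y` from their mean: the disagreement that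
a consensus protocol has to contract. -/
noncomputable def spread (y : ι → ℝ) : ℝ := ∑ i, Fintype.balance y i ^ 2

theorem spread_const (c : ℝ) : spread (fun _ : ι => c) = 0 :=
  Finset.sum_eq_zero fun i _ => by
    have := Nonempty.intro i
    simp [Fintype.balance_apply]

theorem le_expect_add_of_spread_le {y : ι → ℝ} {B : ℝ} (hB : 0 ≤ B) (hy : spread y ≤ B ^ 2)
    (i : ι) : y i ≤ 𝔼 j, y j + B := by
  have h : Fintype.balance y i ^ 2 ≤ spread y :=
    Finset.single_le_sum (f := fun i => Fintype.balance y i ^ 2) (fun i _ => sq_nonneg _)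
      (Finset.mem_univ i)
  have := (abs_le_of_sq_le_sq' (h.trans hy) hB).2
  rw [Fintype.balance_apply] at this
  linarith

theorem lt_div_card_of_sum_le_of_spread_le {y : ι → ℝ} {c μ γ : ℝ} (hμ : 0 < μ) (hγ : 0 < γ)
    (hsum : ∑ i, y i ≤ (c - μ) * γ)
    (hspread : spread y ≤ (μ / (2 * Fintype.card ι)) ^ 2 * γ ^ 2) (i : ι) :
    y i < c * γ / Fintype.card ι := by
  have := Nonempty.intro i
  have hn : (0 : ℝ) < Fintype.card ι := by positivity
  rw [← mul_pow] at hspread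
  calc y i ≤ 𝔼 j, y j + μ / (2 * Fintype.card ι) * γ :=
        le_expect_add_of_spread_le (by positivity) hspread i
    _ ≤ (c - μ) * γ / Fintype.card ι + μ / (2 * Fintype.card ι) * γ := by
        rw [Fintype.expect_eq_sum_div_card]; gcongr
    _ = c * γ / Fintype.card ι - μ * γ / (2 * Fintype.card ι) := by field_simp; ring
    _ < c * γ / Fintype.card ι := sub_lt_self _ (by positivity)

theorem hasDerivWithinAt_spread {y : ℝ → ι → ℝ} {y' : ι → ℝ} {S : Set ℝ} {s : ℝ}
    (hy : HasDerivWithinAt y y' S s) :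
    HasDerivWithinAt (fun s => spread (y s)) (2 * (Fintype.balance (y s) ⬝ᵥ y')) S s := by
  have hb (i : ι) :
      HasDerivWithinAt (fun s => Fintype.balance (y s) i) (Fintype.balance y' i) S s := by
    simp only [Fintype.balance_apply, Fintype.expect_eq_sum_div_card]
    have hy := hasDerivWithinAt_pi.1 hy
    exact (hy i).fun_sub ((HasDerivWithinAt.fun_sum fun j _ => hy j).div_const _)
  refine (HasDerivWithinAt.fun_sum fun i _ => (hb i).fun_pow 2).congr_deriv ?_
  have mean_part : ∑ i, Fintype.balance (y s) i * 𝔼 j, y' j = 0 := by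
    rw [← Finset.sum_mul, Fintype.sum_balance, zero_mul]
  calc ∑ i, (2 : ℕ) * Fintype.balance (y s) i ^ (2 - 1) * Fintype.balance y' i
      = 2 * (Fintype.balance (y s) ⬝ᵥ y' - ∑ i, Fintype.balance (y s) i * 𝔼 j, y' j) := by
        rw [dotProduct, ← Finset.sum_sub_distrib, Finset.mul_sum]
        refine Finset.sum_congr rfl fun i _ => ?_
        rw [Fintype.balance_apply y']; push_cast; ring
    _ = 2 * (Fintype.balance (y s) ⬝ᵥ y') := by rw [mean_part, sub_zero]

theorem two_mul_dotProduct_le {k B : ℝ} (hk : 1 ≤ k) (y w : ι → ℝ) (hw : ‖w‖ ≤ B) :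
    2 * (y ⬝ᵥ w) ≤ k * ∑ i, y i ^ 2 + Fintype.card ι * B ^ 2 := by
  have entry (i : ι) : 2 * (y i * w i) ≤ k * y i ^ 2 + B ^ 2 := by
    have : w i ^ 2 ≤ B ^ 2 := sq_le_sq' (by linarith [neg_le_of_abs_le (norm_le_pi_norm w i)])
      ((le_abs_self _).trans ((norm_le_pi_norm w i).trans hw))
    nlinarith [sq_nonneg (y i - w i), sq_nonneg (y i)]
  calc 2 * (y ⬝ᵥ w) = ∑ i, 2 * (y i * w i) := Finset.mul_sum _ _ _
    _ ≤ ∑ i, (k * y i ^ 2 + B ^ 2) := Finset.sum_le_sum fun i _ => entry i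
    _ = _ := by simp [Finset.sum_add_distrib, Finset.mul_sum]

variable [DecidableEq ι] (G : SimpleGraph ι) [DecidableRel G.Adj]

theorem sum_lapMatrix_mulVec (y : ι → ℝ) : ∑ i, (G.lapMatrix ℝ *ᵥ y) i = 0 := by
  rw [← one_dotProduct, dotProduct_mulVec, ← mulVec_transpose, (G.isSymm_lapMatrix (R := ℝ)).eq]
  exact (congrArg (· ⬝ᵥ y) G.lapMatrix_mulVec_const_eq_zero).trans (zero_dotProduct y)

theorem balance_dotProduct_lapMatrix_mulVec (y : ι → ℝ) :
    Fintype.balance y ⬝ᵥ (G.lapMatrix ℝ *ᵥ y) = y ⬝ᵥ (G.lapMatrix ℝ *ᵥ y) := by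
  rw [Fintype.balance, sub_dotProduct, sub_eq_self]
  simp only [dotProduct, const_apply, ← Finset.mul_sum, sum_lapMatrix_mulVec, mul_zero]

variable {G}

theorem sq_sub_le_of_adj (y : ι → ℝ) {u v : ι} (h : G.Adj u v) :
    (y u - y v) ^ 2 ≤ 2 * (y ⬝ᵥ (G.lapMatrix ℝ *ᵥ y)) := by
  rw [← toLinearMap₂'_apply', G.lapMatrix_toLinearMap₂' ℝ, mul_div_cancel₀ _ two_ne_zero]
  have nonneg (i j : ι) : 0 ≤ if G.Adj i j then (y i - y j) ^ 2 else 0 := by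
    split_ifs <;> positivity
  calc (y u - y v) ^ 2 = if G.Adj u v then (y u - y v) ^ 2 else 0 := (if_pos h).symm
    _ ≤ ∑ j, if G.Adj u j then (y u - y j) ^ 2 else 0 :=
        Finset.single_le_sum (f := fun j => if G.Adj u j then (y u - y j) ^ 2 else 0)
          (fun j _ => nonneg u j) (Finset.mem_univ v)
    _ ≤ _ := Finset.single_le_sum (f := fun i => ∑ j, if G.Adj i j then (y i - y j) ^ 2 else 0)
        (fun i _ => Finset.sum_nonneg fun j _ => nonneg i j) (Finset.mem_univ u)

theorem abs_sub_le_length_mul_sqrt (y : ι → ℝ) {u v : ι} (p : G.Walk u v) :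
    |y u - y v| ≤ p.length * √(2 * (y ⬝ᵥ (G.lapMatrix ℝ *ᵥ y))) := by
  induction p with
  | nil => simp
  | @cons u w v h p ih =>
    calc |y u - y v| ≤ |y u - y w| + |y w - y v| := abs_sub_le _ _ _
      _ ≤ √(2 * (y ⬝ᵥ (G.lapMatrix ℝ *ᵥ y)))
          + p.length * √(2 * (y ⬝ᵥ (G.lapMatrix ℝ *ᵥ y))) :=
          add_le_add (abs_le_sqrt (sq_sub_le_of_adj y h)) ih
      _ = _ := by rw [SimpleGraph.Walk.length_cons]; push_cast; ring

/- Two vertices of a connected graph are joined by a path with fewer than `n` edges, across each of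
which `y` varies by at most the root of twice the Laplacian form. -/
theorem spread_le_mul_dotProduct_lapMatrix (hG : G.Connected) (y : ι → ℝ) :
    spread y ≤ 2 * Fintype.card ι ^ 3 * (y ⬝ᵥ (G.lapMatrix ℝ *ᵥ y)) := by
  set Q := y ⬝ᵥ (G.lapMatrix ℝ *ᵥ y)
  have hQ : 0 ≤ Q := by
    simpa [Q] using (G.posSemidef_lapMatrix ℝ).dotProduct_mulVec_nonneg y
  have := hG.nonempty
  have abs_sub_le (u v : ι) : |y u - y v| ≤ Fintype.card ι * √(2 * Q) := by
    obtain ⟨p, hp⟩ := hG.preconnected.exists_isPath u v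
    refine (abs_sub_le_length_mul_sqrt y p).trans ?_
    gcongr
    exact hp.length_lt.le
  have abs_balance_le (i : ι) : |Fintype.balance y i| ≤ Fintype.card ι * √(2 * Q) := by
    rw [Fintype.balance_apply, ← Fintype.expect_const (ι := ι) (y i), ← Finset.expect_sub_distrib]
    exact (Finset.abs_expect_le _ _).trans
      (Finset.expect_le Finset.univ_nonempty fun j _ => abs_sub_le i j)
  calc spread y ≤ ∑ _i : ι, (Fintype.card ι * √(2 * Q)) ^ 2 :=
        Finset.sum_le_sum fun i _ => sq_le_sq' (by linarith [(abs_le.1 (abs_balance_le i)).1])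
          (abs_le.1 (abs_balance_le i)).2
    _ = 2 * Fintype.card ι ^ 3 * Q := by
        rw [Finset.sum_const, Finset.card_univ, nsmul_eq_mul, mul_pow, sq_sqrt (by positivity)]
        ring

variable (G)

/-- On the time set `S`, the estimate `y` follows the signal `w` by dynamic average consensus with
gain `ρ`, `ẏ = ẇ - ρ L y`, all derivatives being taken within `S`. -/
def TracksOn (ρ : ℝ) (w y : ℝ → ι → ℝ) (S : Set ℝ) : Prop :=
  ∀ s ∈ S, HasDerivWithinAt y (derivWithin w S s - ρ • (G.lapMatrix ℝ *ᵥ y s)) S s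

variable {G} {ρ : ℝ} {w y : ℝ → ι → ℝ}

theorem TracksOn.continuousOn {S : Set ℝ} (h : TracksOn G ρ w y S) : ContinuousOn y S :=
  fun s hs => (h s hs).continuousWithinAt

theorem TracksOn.mono {S T : Set ℝ} (h : TracksOn G ρ w y T) (hST : S ⊆ T)
    (hw : DifferentiableOn ℝ w T) : TracksOn G ρ w y S := fun s hs => by
  by_cases hS : UniqueDiffWithinAt ℝ S s
  · rw [derivWithin_subset hST hS (hw s (hST hs))]
    exact (h s (hST hs)).mono hST
  · exact HasFDerivWithinAt.of_not_accPt fun hacc => hS hacc.uniqueDiffWithinAt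

theorem TracksOn.congr {S : Set ℝ} {w₁ y₁ : ℝ → ι → ℝ} (h : TracksOn G ρ w y S)
    (hw : EqOn w₁ w S) (hy : EqOn y₁ y S) : TracksOn G ρ w₁ y₁ S := fun s hs => by
  rw [derivWithin_congr hw (hw hs), hy hs]
  exact (h s hs).congr hy (hy hs)

theorem TracksOn.sum_eq {a b : ℝ} (h : TracksOn G ρ w y (Icc a b))
    (hw : DifferentiableOn ℝ w (Icc a b)) (ha : ∑ i, y a i = ∑ i, w a i) :
    ∀ s ∈ Icc a b, ∑ i, y s i = ∑ i, w s i := by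
  have deriv_eq_zero : ∀ s ∈ Icc a b,
      HasDerivWithinAt (fun s => ∑ i, (y s i - w s i)) 0 (Icc a b) s := fun s hs => by
    refine (HasDerivWithinAt.fun_sum fun i _ => (hasDerivWithinAt_pi.1 (h s hs) i).fun_sub
      (hasDerivWithinAt_pi.1 (hw s hs).hasDerivWithinAt i)).congr_deriv ?_
    simp [← Finset.mul_sum, sum_lapMatrix_mulVec]
  intro s hs
  have := constant_of_has_deriv_right_zero (fun s hs => (deriv_eq_zero s hs).continuousWithinAt)
    (fun s hs => (hasDerivWithinAt_Ioi_of_Icc hs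
      (deriv_eq_zero s (Ico_subset_Icc_self hs))).Ici_of_Ioi) s hs
  rwa [Finset.sum_sub_distrib, Finset.sum_sub_distrib, ha, sub_self, sub_eq_zero] at this

/- With `k = ρ / (2 n³)`, the Laplacian term contributes `-2k spread y` to the derivative of the
spread, half of which absorbs the cross term with `ẇ`. -/
theorem TracksOn.spread_le (hG : G.Connected) {a b C β r g : ℝ} (hβ : 0 < β) (hr : 0 ≤ r)
    (hρ : (1 + 2 * r + Fintype.card ι * C ^ 2 / β) * (2 * Fintype.card ι ^ 3) ≤ ρ)
    (h : TracksOn G ρ w y (Icc a b))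
    (hw : ∀ s ∈ Icc a b, ‖derivWithin w (Icc a b) s‖ ≤ C * (g * exp (-r * s)))
    (ha : spread (y a) ≤ β * (g * exp (-r * a)) ^ 2) :
    ∀ s ∈ Icc a b, spread (y s) ≤ β * (g * exp (-r * s)) ^ 2 := by
  have hn : 0 < (2 * Fintype.card ι ^ 3 : ℝ) := by
    have := hG.nonempty; positivity
  set k := ρ / (2 * Fintype.card ι ^ 3) with hk
  have hkβ : 1 + 2 * r + Fintype.card ι * C ^ 2 / β ≤ k := (le_div_iff₀ hn).2 hρ
  have hq : 0 ≤ Fintype.card ι * C ^ 2 / β := by positivity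
  have threshold (s : ℝ) : β * (g * exp (-r * s)) ^ 2 = β * g ^ 2 * exp (-(2 * r) * s) := by
    rw [mul_pow, ← exp_nat_mul, mul_assoc]; push_cast; ring_nf
  intro s hs
  rw [threshold]
  refine le_mul_exp_neg_of_deriv_le (k := k) (fun s hs => hasDerivWithinAt_spread (h s hs))
    (ha.trans_eq (threshold a)) (fun s hs => ?_) s hs
  rw [← threshold]
  set B := g * exp (-r * s)
  set Q := y s ⬝ᵥ (G.lapMatrix ℝ *ᵥ y s)
  have laplacian : k * spread (y s) ≤ ρ * Q := by
    rw [hk, div_mul_eq_mul_div, div_le_iff₀ hn]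
    have hρ0 : 0 ≤ ρ := (by positivity : (0 : ℝ) ≤ _).trans hρ
    nlinarith [mul_le_mul_of_nonneg_left (spread_le_mul_dotProduct_lapMatrix hG (y s)) hρ0]
  have cross : 2 * (Fintype.balance (y s) ⬝ᵥ derivWithin w (Icc a b) s)
      ≤ k * spread (y s) + Fintype.card ι * (C * B) ^ 2 :=
    two_mul_dotProduct_le (by linarith) _ _ (hw s hs)
  have gain : Fintype.card ι * (C * B) ^ 2 ≤ (k - 2 * r) * (β * B ^ 2) := by
    have : Fintype.card ι * C ^ 2 ≤ (k - 2 * r) * β := (div_le_iff₀ hβ).1 (by linarith)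
    nlinarith [mul_le_mul_of_nonneg_right this (sq_nonneg B)]
  rw [dotProduct_sub, dotProduct_smul, balance_dotProduct_lapMatrix_mulVec, smul_eq_mul]
  linarith

theorem exists_tracksOn_Ici (G : SimpleGraph ι) [DecidableRel G.Adj] (ρ : ℝ) {w : ℝ → ι → ℝ}
    {a : ℝ} (hw : DifferentiableOn ℝ w (Ici a)) (y₀ : ι → ℝ) :
    ∃ y, y a = y₀ ∧ TracksOn G ρ w y (Ici a) := by
  let A : (ι → ℝ) →L[ℝ] (ι → ℝ) := -(ρ • (G.lapMatrix ℝ).mulVecLin.toContinuousLinearMap)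
  have hwc : Continuous fun t => w (max a t) :=
    hw.continuousOn.comp_continuous (by fun_prop) fun t => le_max_left a t
  -- The deviation `ζ = y - w` solves the Lipschitz equation `ζ' = A (ζ + w)`.
  obtain ⟨ζ, hζa, hζ⟩ := exists_isIntegralCurveOn_Ici_of_lipschitz
    (v := fun t ζ => A (ζ + w (max a t))) (K := ‖A‖₊)
    (fun t => LipschitzWith.of_dist_le_mul fun ζ₁ ζ₂ => by
      simpa using A.lipschitz.dist_le_mul (ζ₁ + w (max a t)) (ζ₂ + w (max a t)))
    (fun ζ => A.continuous.comp (continuous_const.add hwc)) a (y₀ - w a)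
  refine ⟨fun s => w s + ζ s, by simp [hζa], fun s hs => ?_⟩
  refine ((hw s hs).hasDerivWithinAt.fun_add (hζ s hs)).congr_deriv ?_
  change derivWithin w (Ici a) s + A (ζ s + w (max a s)) = _
  rw [max_eq_right (mem_Ici.1 hs), add_comm (ζ s), sub_eq_add_neg]
  rfl

end Consensus

section LinearGrowth

variable {E F H : Type*} [NormedAddCommGroup E] [NormedSpace ℝ E] [NormedAddCommGroup F]
  [NormedSpace ℝ F] [NormedAddCommGroup H] [NormedSpace ℝ H]

/-- The derivative of `h` at `x` is bounded by a multiple of `‖x‖`, as for a quadratic form.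
It makes a signal `h(x, e)` vary, along a sampled trajectory, at a rate of order `‖x‖² + ‖e‖²`. -/
structure HasLinearGrowthDeriv (h : E → F) : Prop where
  differentiable : Differentiable ℝ h
  isBigO_fderiv : fderiv ℝ h =O[⊤] fun x => x

theorem hasLinearGrowthDeriv_of_lipschitz_fderiv {h : E → F} {K : ℝ≥0} (hd : Differentiable ℝ h)
    (hK : LipschitzWith K (fderiv ℝ h)) (h0 : fderiv ℝ h 0 = 0) : HasLinearGrowthDeriv h where
  differentiable := hd
  isBigO_fderiv := isBigO_top.2 ⟨K, fun x => by simpa [h0] using hK.norm_sub_le x 0⟩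

theorem hasLinearGrowthDeriv_norm_sq {E : Type*} [NormedAddCommGroup E] [InnerProductSpace ℝ E] :
    HasLinearGrowthDeriv fun x : E => ‖x‖ ^ 2 where
  differentiable := differentiable_id.norm_sq ℝ
  isBigO_fderiv := isBigO_top.2 ⟨2, fun x => by
    rw [fderiv_norm_sq_apply, ← Nat.cast_smul_eq_nsmul ℝ, norm_smul, innerSL_apply_norm]
    norm_num⟩

theorem hasLinearGrowthDeriv_pi {ι : Type*} [Fintype ι] {h : E → ι → ℝ}
    (hh : ∀ i, HasLinearGrowthDeriv fun x => h x i) : HasLinearGrowthDeriv h where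
  differentiable := differentiable_pi.2 fun i => (hh i).differentiable
  isBigO_fderiv := by
    obtain ⟨c, hc⟩ := isBigO_top.1 (isBigO_pi.2 fun i => (hh i).isBigO_fderiv)
    refine isBigO_top.2 ⟨c, fun x => ?_⟩
    rw [fderiv_pi fun i => (hh i).differentiable x]
    exact ContinuousLinearMap.norm_pi_le_of_le
      (fun i => (norm_le_pi_norm (fun i => fderiv ℝ (fun x => h x i) x) i).trans (hc x))
      ((norm_nonneg _).trans (hc x))

namespace HasLinearGrowthDeriv

variable {h h₁ h₂ : E → F}

theorem add (hh₁ : HasLinearGrowthDeriv h₁) (hh₂ : HasLinearGrowthDeriv h₂) :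
    HasLinearGrowthDeriv fun x => h₁ x + h₂ x where
  differentiable := hh₁.differentiable.fun_add hh₂.differentiable
  isBigO_fderiv := (hh₁.isBigO_fderiv.add hh₂.isBigO_fderiv).congr_left fun x =>
    (fderiv_fun_add (hh₁.differentiable x) (hh₂.differentiable x)).symm

theorem const_smul (hh : HasLinearGrowthDeriv h) (c : ℝ) :
    HasLinearGrowthDeriv fun x => c • h x where
  differentiable := hh.differentiable.fun_const_smul c
  isBigO_fderiv := (hh.isBigO_fderiv.const_smul_left c).congr_left fun x =>
    (fderiv_fun_const_smul (hh.differentiable x) c).symm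

theorem comp_continuousLinearMap (hh : HasLinearGrowthDeriv h) (A : H →L[ℝ] E) :
    HasLinearGrowthDeriv fun x => h (A x) where
  differentiable := hh.differentiable.comp A.differentiable
  isBigO_fderiv := by
    obtain ⟨c, hc₀, hc⟩ := hh.isBigO_fderiv.exists_nonneg
    rw [isBigOWith_top] at hc
    refine isBigO_top.2 ⟨c * ‖A‖ * ‖A‖, fun x => ?_⟩
    rw [show fderiv ℝ (fun x => h (A x)) x = (fderiv ℝ h (A x)).comp A from
      ((hh.differentiable _).hasFDerivAt.comp x A.hasFDerivAt).fderiv]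
    calc ‖(fderiv ℝ h (A x)).comp A‖ ≤ ‖fderiv ℝ h (A x)‖ * ‖A‖ :=
          ContinuousLinearMap.opNorm_comp_le _ _
      _ ≤ c * (‖A‖ * ‖x‖) * ‖A‖ := by
          gcongr; exact (hc _).trans (by gcongr; exact A.le_opNorm x)
      _ = c * ‖A‖ * ‖A‖ * ‖x‖ := by ring

end HasLinearGrowthDeriv

end LinearGrowth

theorem norm_derivWithin_le_of_hasDerivWithinAt {F : Type*} [NormedAddCommGroup F] [NormedSpace ℝ F]
    {y : ℝ → F} {y' : F} {S : Set ℝ} {s : ℝ} (hy : HasDerivWithinAt y y' S s) :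
    ‖derivWithin y S s‖ ≤ ‖y'‖ := by
  by_cases hS : UniqueDiffWithinAt ℝ S s
  · rw [hy.derivWithin hS]
  · rw [derivWithin_zero_of_not_uniqueDiffWithinAt hS, norm_zero]
    exact norm_nonneg _

section SampledTrajectory

variable {E : Type*} [NormedAddCommGroup E] [NormedSpace ℝ E]

/-- On `[a, b]`, `x` solves `ẋ = f(x, e)` with the error `e = x(a) - x` since the last sample. -/
def IsSampledOn (f : E → E → E) (x : ℝ → E) (a b : ℝ) : Prop :=
  ∀ s ∈ Icc a b, HasDerivWithinAt x (f (x s) (x a - x s)) (Icc a b) s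

theorem IsSampledOn.differentiableOn {f : E → E → E} {x : ℝ → E} {a b : ℝ}
    (hx : IsSampledOn f x a b) : DifferentiableOn ℝ x (Icc a b) := fun s hs =>
  (hx s hs).differentiableWithinAt

theorem IsSampledOn.hasDerivWithinAt_comp {F : Type*} [NormedAddCommGroup F] [NormedSpace ℝ F]
    {f : E → E → E} {x : ℝ → E} {a b s : ℝ} (hx : IsSampledOn f x a b) {h : E × E → F}
    (hh : Differentiable ℝ h) (hs : s ∈ Icc a b) :
    HasDerivWithinAt (fun τ => h (x τ, x a - x τ))
      (fderiv ℝ h (x s, x a - x s) (f (x s) (x a - x s), -f (x s) (x a - x s))) (Icc a b) s :=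
  (hh _).hasFDerivAt.comp_hasDerivWithinAt (f := fun τ => (x τ, x a - x τ)) s
    ((hx s hs).prodMk ((hx s hs).const_sub (x a)))

theorem HasLinearGrowthDeriv.exists_norm_derivWithin_le {F : Type*} [NormedAddCommGroup F]
    [NormedSpace ℝ F] {h : E × E → F} (hh : HasLinearGrowthDeriv h) {f : E → E → E} {Lf : ℝ}
    (hf : ∀ x e, ‖f x e‖ ≤ Lf * (‖x‖ + ‖e‖)) :
    ∃ A, 0 ≤ A ∧ ∀ (x : ℝ → E) (a b : ℝ), IsSampledOn f x a b → ∀ s ∈ Icc a b,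
      ‖derivWithin (fun τ => h (x τ, x a - x τ)) (Icc a b) s‖
        ≤ A * (‖x s‖ ^ 2 + ‖x a - x s‖ ^ 2) := by
  obtain ⟨c, hc₀, hc⟩ := hh.isBigO_fderiv.exists_nonneg
  rw [isBigOWith_top] at hc
  refine ⟨2 * c * |Lf|, by positivity, fun x a b hx s hs => ?_⟩
  refine (norm_derivWithin_le_of_hasDerivWithinAt
    (hx.hasDerivWithinAt_comp hh.differentiable hs)).trans ?_
  set e := x a - x s
  have hfx : ‖f (x s) e‖ ≤ |Lf| * (‖x s‖ + ‖e‖) :=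
    (hf _ _).trans (by gcongr; exact le_abs_self Lf)
  calc ‖fderiv ℝ h (x s, e) (f (x s) e, -f (x s) e)‖
      ≤ ‖fderiv ℝ h (x s, e)‖ * ‖(f (x s) e, -f (x s) e)‖ := ContinuousLinearMap.le_opNorm _ _
    _ ≤ c * (‖x s‖ + ‖e‖) * (|Lf| * (‖x s‖ + ‖e‖)) := by
        gcongr
        · refine (hc _).trans ?_
          gcongr
          exact max_le (by simp) (by simp)
        · simpa [Prod.norm_mk] using hfx
    _ = c * |Lf| * (‖x s‖ + ‖e‖) ^ 2 := by ring
    _ ≤ c * |Lf| * (2 * (‖x s‖ ^ 2 + ‖e‖ ^ 2)) := by gcongr; exact add_sq_le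
    _ = 2 * c * |Lf| * (‖x s‖ ^ 2 + ‖e‖ ^ 2) := by ring

end SampledTrajectory

section Lyapunov

variable {E : Type*} [NormedAddCommGroup E] [NormedSpace ℝ E]

/- If `v = f 0` were nonzero, then `V(t v) ≥ c₁ t² ‖v‖²`, while `dV(s v) v ≤ dV(s v) (v - f(s v))`
is of smaller order than `s`. -/
theorem apply_zero_eq_zero_of_lyapunov {V : E → ℝ} {f : E → E} {c₁ c₄ : ℝ} (hc₁ : 0 < c₁)
    (hV : Differentiable ℝ V) (hV0 : V 0 = 0) (hlower : ∀ x, c₁ * ‖x‖ ^ 2 ≤ V x)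
    (hgrad : ∀ x, ‖fderiv ℝ V x‖ ≤ c₄ * ‖x‖) (hdecay : ∀ x, fderiv ℝ V x (f x) ≤ 0)
    (hf : ContinuousAt f 0) : f 0 = 0 := by
  by_contra hne
  set v := f 0 with hv
  have hvpos : 0 < ‖v‖ := norm_pos_iff.2 hne
  have hlim : Tendsto (fun s : ℝ => c₄ * ‖v - f (s • v)‖) (𝓝 0) (𝓝 0) := by
    have hcont : ContinuousAt (fun s : ℝ => f (s • v)) 0 :=
      ContinuousAt.comp (f := fun s : ℝ => s • v) (by simpa using hf) (by fun_prop)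
    simpa [ContinuousAt, ← hv] using (hcont.const_sub v).norm.const_mul c₄
  obtain ⟨t, ht, hsmall⟩ := (nhdsGT_basis (0 : ℝ)).eventually_iff.1
    ((hlim.mono_left nhdsWithin_le_nhds).eventually_lt_const (mul_pos hc₁ hvpos))
  have hray (s : ℝ) : HasDerivAt (fun s : ℝ => V (s • v)) (fderiv ℝ V (s • v) v) s :=
    (hV (s • v)).hasFDerivAt.comp_hasDerivAt s (by simpa using (hasDerivAt_id s).smul_const v)
  obtain ⟨s, hs, hslope⟩ := exists_hasDerivAt_eq_slope (fun s : ℝ => V (s • v)) _ ht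
    (fun s _ => (hray s).continuousAt.continuousWithinAt) fun s _ => hray s
  have slope_lt : fderiv ℝ V (s • v) v < c₁ * t * ‖v‖ ^ 2 := by
    calc fderiv ℝ V (s • v) v
        = fderiv ℝ V (s • v) (f (s • v)) + fderiv ℝ V (s • v) (v - f (s • v)) := by
          rw [map_sub]; ring
      _ ≤ ‖fderiv ℝ V (s • v)‖ * ‖v - f (s • v)‖ := by
          linarith [hdecay (s • v), (le_abs_self _).trans
            ((fderiv ℝ V (s • v)).le_opNorm (v - f (s • v)))]
      _ ≤ c₄ * ‖s • v‖ * ‖v - f (s • v)‖ := by gcongr; exact hgrad _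
      _ = s * ‖v‖ * (c₄ * ‖v - f (s • v)‖) := by
          rw [norm_smul, norm_of_nonneg hs.1.le]; ring
      _ < s * ‖v‖ * (c₁ * ‖v‖) := by
          exact mul_lt_mul_of_pos_left (hsmall hs) (mul_pos hs.1 hvpos)
      _ ≤ t * ‖v‖ * (c₁ * ‖v‖) := by have := hs.2; gcongr
      _ = c₁ * t * ‖v‖ ^ 2 := by ring
  have le_slope : c₁ * t * ‖v‖ ^ 2 ≤ fderiv ℝ V (s • v) v := by
    have := hlower (t • v)
    rw [norm_smul, norm_of_nonneg ht.le] at this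
    rw [hslope, zero_smul, hV0, sub_zero, sub_zero, le_div_iff₀ ht]
    linarith
  exact slope_lt.not_ge le_slope

end Lyapunov

section ClosedLoop

variable {N m : ℕ} {d : Fin N → ℕ}

theorem exists_lipschitz_closedLoop {F : NetState d → Input m → NetState d}
    {κ : NetState d → Input m}
    (hF : ∃ K, LipschitzWith K (fun p : NetState d × Input m => F p.1 p.2))
    (hκ : ∃ K, LipschitzWith K κ) : ∃ Lf : ℝ, 0 < Lf ∧ ∀ x e x' e',
      ‖closedLoop F κ x e - closedLoop F κ x' e'‖ ≤ Lf * (‖x - x'‖ + ‖e - e'‖) := by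
  obtain ⟨K, hK⟩ := hF
  obtain ⟨K', hK'⟩ := hκ
  refine ⟨K * (1 + K') + 1, by positivity, fun x e x' e' => ?_⟩
  have hsum : ‖x + e - (x' + e')‖ ≤ ‖x - x'‖ + ‖e - e'‖ := by
    rw [add_sub_add_comm]; exact norm_add_le _ _
  have hinput : ‖κ (x + e) - κ (x' + e')‖ ≤ K' * (‖x - x'‖ + ‖e - e'‖) :=
    (hK'.norm_sub_le _ _).trans (by gcongr)
  calc ‖closedLoop F κ x e - closedLoop F κ x' e'‖
      ≤ K * ‖(x, κ (x + e)) - (x', κ (x' + e'))‖ := hK.norm_sub_le (x, _) (x', _)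
    _ ≤ K * ((1 + K') * (‖x - x'‖ + ‖e - e'‖)) := by
        rw [Prod.mk_sub_mk, Prod.norm_mk, one_add_mul]
        gcongr
        exact max_le (by linarith [norm_nonneg (e - e'), norm_nonneg (κ (x + e) - κ (x' + e'))])
          (by linarith [norm_nonneg (x - x'), norm_nonneg (e - e')])
    _ ≤ (K * (1 + K') + 1) * (‖x - x'‖ + ‖e - e'‖) := by
        linarith [norm_nonneg (x - x'), norm_nonneg (e - e')]

theorem IsExpLyapunov.exists_areRateConstants {f : NetState d → NetState d → NetState d}
    {V : NetState d → ℝ} {c₁ c₂ c₃ c₄ Lf : ℝ} (hV : IsExpLyapunov f V c₁ c₂ c₃ c₄) (hLf : 0 < Lf)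
    (hf : ∀ x e x' e', ‖f x e - f x' e'‖ ≤ Lf * (‖x - x'‖ + ‖e - e'‖)) :
    ∃ cα cγ : ℝ, AreRateConstants f V Lf cα cγ := by
  have hc₃ := hV.pos₃
  have hc₄ := hV.pos₄
  refine ⟨c₃ / 2, (c₄ * Lf) ^ 2 / (2 * c₃), hLf, by positivity, by positivity, hf, fun x e => ?_⟩
  have young : c₄ * ‖x‖ * (Lf * ‖e‖) ≤
      c₃ / 2 * ‖x‖ ^ 2 + (c₄ * Lf) ^ 2 / (2 * c₃) * ‖e‖ ^ 2 := by
    rw [← sub_nonneg]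
    calc 0 ≤ (c₃ * ‖x‖ - c₄ * Lf * ‖e‖) ^ 2 / (2 * c₃) := by positivity
      _ = _ := by field_simp; ring
  have perturbation : fderiv ℝ V x (f x e - f x 0) ≤ c₄ * ‖x‖ * (Lf * ‖e‖) :=
    (le_abs_self _).trans <| ((fderiv ℝ V x).le_opNorm _).trans <|
      mul_le_mul (hV.grad x) (by simpa using hf x e x 0) (norm_nonneg _) (by positivity)
  rw [map_sub] at perturbation
  linarith [hV.decay x]

theorem IsExpLyapunov.apply_zero_zero {f : NetState d → NetState d → NetState d}
    {V : NetState d → ℝ} {c₁ c₂ c₃ c₄ : ℝ} (hV : IsExpLyapunov f V c₁ c₂ c₃ c₄)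
    (hd : Differentiable ℝ V) (hf : ContinuousAt (fun x => f x 0) 0) : f 0 0 = 0 := by
  have hV0 : V 0 = 0 := le_antisymm (by simpa using hV.upper 0) (by simpa using hV.lower 0)
  refine apply_zero_eq_zero_of_lyapunov hV.pos₁ hd hV0 hV.lower hV.grad
    (f := fun x => f x 0) (fun x => ?_) hf
  exact (hV.decay x).trans (mul_nonpos_of_nonpos_of_nonneg (neg_nonpos.2 hV.pos₃.le) (sq_nonneg _))

theorem AreRateConstants.lipschitzWith_uncurry {f : NetState d → NetState d → NetState d}
    {V : NetState d → ℝ} {Lf cα cγ : ℝ} (h : AreRateConstants f V Lf cα cγ) :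
    LipschitzWith (2 * Lf).toNNReal (uncurry f) :=
  LipschitzWith.of_dist_le' fun p q => by
    have hL := h.pos_L
    calc dist (uncurry f p) (uncurry f q) ≤ Lf * (‖p.1 - q.1‖ + ‖p.2 - q.2‖) := by
          rw [dist_eq_norm]; exact h.lipschitz _ _ _ _
      _ ≤ Lf * (dist p q + dist p q) := by
          rw [dist_eq_norm]
          gcongr
          exacts [norm_fst_le (p - q), norm_snd_le (p - q)]
      _ = 2 * Lf * dist p q := by ring

end ClosedLoop

section Trigger

theorem tauD_pos {Lf cα cγ c₂ σ r : ℝ} (hL : 0 < Lf) (hγ : 0 < cγ)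
    (hs : 0 < (1 - σ) * cα - r * c₂) : 0 < tauD Lf cα cγ c₂ σ r := by
  have : 0 < √(((1 - σ) * cα - r * c₂) / cγ) := sqrt_pos.2 (by positivity)
  unfold tauD
  positivity

variable {E : Type*} [NormedAddCommGroup E] [NormedSpace ℝ E]

/-- The centralized trigger function `(σ - 1) c_α ‖x‖² + (r + c_β) V(x) + c_γ ‖e‖²`. It is the sum
of the entries of `W^{xe}`, and bounds the growth of `V` relative to the decay at rate `r`. -/
def globalTrigger (V : E → ℝ) (cα cγ σ r cβ : ℝ) (x e : E) : ℝ :=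
  (σ - 1) * cα * ‖x‖ ^ 2 + (r + cβ) * V x + cγ * ‖e‖ ^ 2

/-- The part of the threshold that is left for the consensus error during the minimal inter-event
time `τ`: the first term comes from the sampling error being small on `[0, τ / 2]`, the second one
from the faster decay of `V`, at rate `r + σ c_α / c₂`, having acted for the time `τ / 2`. -/
noncomputable def margin (Lf cα cγ c₂ σ r cβ : ℝ) : ℝ :=
  min (3 * ((1 - σ) * cα - r * c₂) / (4 * c₂))
    (cβ * (1 - exp (-(σ * cα / c₂) * (tauD Lf cα cγ c₂ σ r / 2))))

/-- The inequalities on the dynamics, the Lyapunov function and the design constants on which the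
performance of the trigger rests. -/
structure TriggerDesign (f : E → E → E) (V : E → ℝ) (c₁ c₂ Lf cα cγ σ r cβ : ℝ) : Prop where
  differentiable : Differentiable ℝ V
  lower : ∀ x, c₁ * ‖x‖ ^ 2 ≤ V x
  upper : ∀ x, V x ≤ c₂ * ‖x‖ ^ 2
  norm_le : ∀ x e, ‖f x e‖ ≤ Lf * (‖x‖ + ‖e‖)
  dissipation : ∀ x e, fderiv ℝ V x (f x e) ≤ -cα * ‖x‖ ^ 2 + cγ * ‖e‖ ^ 2
  pos₁ : 0 < c₁
  pos₂ : 0 < c₂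
  pos_L : 0 < Lf
  pos_α : 0 < cα
  pos_γ : 0 < cγ
  pos_r : 0 < r
  pos_σ : 0 < σ
  slack : 0 < (1 - σ) * cα - r * c₂
  lt_cβ : (1 - σ) * (cα / c₁) - r < cβ
  pos_β : 0 < cβ

theorem IsSampledOn.mono_right {f : E → E → E} {x : ℝ → E} {a b c : ℝ} (hx : IsSampledOn f x a b)
    (hc : c ≤ b) : IsSampledOn f x a c := fun s hs =>
  (hx s (Icc_subset_Icc_right hc hs)).mono (Icc_subset_Icc_right hc)

theorem IsSampledOn.hasDerivWithinAt_value {f : E → E → E} {x : ℝ → E} {a b s : ℝ}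
    (hx : IsSampledOn f x a b) {V : E → ℝ} (hV : Differentiable ℝ V) (hs : s ∈ Icc a b) :
    HasDerivWithinAt (fun s => V (x s)) (fderiv ℝ V (x s) (f (x s) (x a - x s))) (Icc a b) s :=
  (hV (x s)).hasFDerivAt.comp_hasDerivWithinAt s (hx s hs)

namespace TriggerDesign

variable {f : E → E → E} {V : E → ℝ} {c₁ c₂ Lf cα cγ σ r cβ V₀ a b s : ℝ} {x : ℝ → E}
  (D : TriggerDesign f V c₁ c₂ Lf cα cγ σ r cβ)
include D

theorem tauD_pos : 0 < tauD Lf cα cγ c₂ σ r :=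
  DistributedETC.tauD_pos D.pos_L D.pos_γ D.slack

theorem margin_pos : 0 < margin Lf cα cγ c₂ σ r cβ := by
  have hslack := D.slack
  have hc₂ := D.pos₂
  have hrate : 0 < σ * cα / c₂ * (tauD Lf cα cγ c₂ σ r / 2) :=
    mul_pos (div_pos (mul_pos D.pos_σ D.pos_α) hc₂) (half_pos D.tauD_pos)
  exact lt_min (by positivity)
    (mul_pos D.pos_β (sub_pos.2 (exp_lt_one_iff.2 (by linarith))))

theorem value_nonneg (x : E) : 0 ≤ V x :=
  (mul_nonneg D.pos₁.le (sq_nonneg _)).trans (D.lower x)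

theorem norm_sq_add_norm_sq_le {x e : E} {γ : ℝ} (hW : globalTrigger V cα cγ σ r cβ x e ≤ cβ * γ)
    (hV : V x ≤ γ) : ‖x‖ ^ 2 + ‖e‖ ^ 2 ≤ (1 / c₁ + cβ / cγ) * γ := by
  have state_le : ‖x‖ ^ 2 ≤ 1 / c₁ * γ := by
    rw [one_div_mul_eq_div, le_div_iff₀ D.pos₁]; linarith [D.lower x]
  have value_bound : (1 - σ) * cα * ‖x‖ ^ 2 ≤ (r + cβ) * V x := by
    have hσ : 0 ≤ (1 - σ) * (cα / c₁) := by
      rw [← mul_div_assoc]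
      exact div_nonneg (by linarith [D.slack, mul_pos D.pos_r D.pos₂]) D.pos₁.le
    calc (1 - σ) * cα * ‖x‖ ^ 2 = (1 - σ) * (cα / c₁) * (c₁ * ‖x‖ ^ 2) := by
          have := D.pos₁.ne'; field_simp
      _ ≤ (r + cβ) * V x := mul_le_mul (by linarith [D.lt_cβ]) (D.lower x)
          (mul_nonneg D.pos₁.le (sq_nonneg _)) (by linarith [D.lt_cβ])
  have error_le : ‖e‖ ^ 2 ≤ cβ / cγ * γ := by
    rw [div_mul_eq_mul_div, le_div_iff₀ D.pos_γ]
    unfold globalTrigger at hW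
    linarith
  linarith

theorem value_le_of_globalTrigger_le (hx : IsSampledOn f x a b)
    (hW : ∀ s ∈ Icc a b, globalTrigger V cα cγ σ r cβ (x s) (x a - x s)
      ≤ cβ * (V₀ * exp (-r * s)))
    (ha : V (x a) ≤ V₀ * exp (-r * a)) : ∀ s ∈ Icc a b, V (x s) ≤ V₀ * exp (-r * s) := by
  refine le_mul_exp_neg_of_deriv_le (k := r + cβ)
    (fun s hs => hx.hasDerivWithinAt_value D.differentiable hs) ha fun s hs => ?_
  have hσ : 0 ≤ σ * cα * ‖x s‖ ^ 2 :=
    mul_nonneg (mul_pos D.pos_σ D.pos_α).le (sq_nonneg _)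
  have hWs := hW s hs
  unfold globalTrigger at hWs
  linarith [D.dissipation (x s) (x a - x s)]

/- With `q = √(slack / c_γ)`, `L_f τ (1 + q) = q`. Hence `s - a ≤ θ τ` makes `L_f (s - a)` at most
`p / (1 + p)` with `p = θ q`, and the sampling error at most `p ‖x s‖`. -/
theorem norm_error_sq_le (hx : IsSampledOn f x a b) {θ : ℝ} (hθ : θ ∈ Icc 0 1) (hs : s ∈ Icc a b)
    (hsτ : s - a ≤ θ * tauD Lf cα cγ c₂ σ r) :
    cγ * ‖x a - x s‖ ^ 2 ≤ θ ^ 2 * ((1 - σ) * cα - r * c₂) * ‖x s‖ ^ 2 := by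
  have hL := D.pos_L
  set q := √(((1 - σ) * cα - r * c₂) / cγ) with hq
  have hq₀ : 0 ≤ q := sqrt_nonneg _
  have hq_sq : cγ * q ^ 2 = (1 - σ) * cα - r * c₂ := by
    rw [hq, sq_sqrt (div_pos D.slack D.pos_γ).le, mul_div_cancel₀ _ D.pos_γ.ne']
  have tauD_mul : Lf * tauD Lf cα cγ c₂ σ r * (1 + q) = q := by
    unfold tauD; rw [← hq]; field_simp
  have hsa : 0 ≤ s - a := sub_nonneg.2 hs.1
  set τ := tauD Lf cα cγ c₂ σ r
  have duration_le : Lf * (s - a) * (1 + θ * q) ≤ θ * q := by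
    calc Lf * (s - a) * (1 + θ * q) ≤ Lf * (θ * τ) * (1 + q) := by
          have := mul_nonneg hθ.1 hq₀
          have := mul_nonneg hL.le (hsa.trans hsτ)
          gcongr
          exact mul_le_of_le_one_left hq₀ hθ.2
      _ = θ * q := by linear_combination θ * tauD_mul
  have duration_le_one : Lf * (s - a) ≤ 1 := by
    nlinarith [mul_nonneg hθ.1 hq₀, mul_nonneg hL.le hsa]
  have error_le := norm_sub_le_of_norm_deriv_le hL.le duration_le_one (hx.mono_right hs.2)
    (fun u _ => D.norm_le _ _) s (right_mem_Icc.2 hs.1)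
  have error_le_mul : ‖x a - x s‖ ≤ θ * q * ‖x s‖ := by
    have hp : 0 ≤ 1 + θ * q := by linarith [mul_nonneg hθ.1 hq₀]
    nlinarith [mul_le_mul_of_nonneg_right error_le hp, mul_le_mul_of_nonneg_right duration_le
      (add_nonneg (norm_nonneg (x s)) (norm_nonneg (x a - x s)))]
  calc cγ * ‖x a - x s‖ ^ 2 ≤ cγ * (θ * q * ‖x s‖) ^ 2 := by have := D.pos_γ; gcongr
    _ = θ ^ 2 * ((1 - σ) * cα - r * c₂) * ‖x s‖ ^ 2 := by rw [← hq_sq]; ring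

theorem globalTrigger_le_of_norm_error_sq_le {θ : ℝ} (hθ : θ ^ 2 ≤ 1) {x e : E}
    (he : cγ * ‖e‖ ^ 2 ≤ θ ^ 2 * ((1 - σ) * cα - r * c₂) * ‖x‖ ^ 2) :
    globalTrigger V cα cγ σ r cβ x e
      ≤ (cβ - (1 - θ ^ 2) * ((1 - σ) * cα - r * c₂) / c₂) * V x := by
  have hk : 0 ≤ (1 - θ ^ 2) * ((1 - σ) * cα - r * c₂) / c₂ + r :=
    add_nonneg (div_nonneg (mul_nonneg (sub_nonneg.2 hθ) D.slack.le) D.pos₂.le) D.pos_r.le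
  have hV := mul_le_mul_of_nonneg_left (D.upper x) hk
  have : (1 - θ ^ 2) * ((1 - σ) * cα - r * c₂) / c₂ * (c₂ * ‖x‖ ^ 2)
      = (1 - θ ^ 2) * ((1 - σ) * cα - r * c₂) * ‖x‖ ^ 2 := by
    have := D.pos₂.ne'; field_simp
  unfold globalTrigger
  linarith

theorem value_le_mul_exp (hx : IsSampledOn f x a b) (hb : b - a ≤ tauD Lf cα cγ c₂ σ r) :
    ∀ s ∈ Icc a b, V (x s) ≤ V (x a) * exp (-(r + σ * cα / c₂) * (s - a)) := by
  refine le_mul_exp_of_deriv_le (fun s hs => hx.hasDerivWithinAt_value D.differentiable hs) le_rfl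
    fun s hs => ?_
  have herror := D.norm_error_sq_le hx (θ := 1) (by simp) hs (by linarith [hs.2])
  have hk : 0 ≤ r + σ * cα / c₂ := add_nonneg D.pos_r.le
    (div_nonneg (mul_pos D.pos_σ D.pos_α).le D.pos₂.le)
  have hV := mul_le_mul_of_nonneg_left (D.upper (x s)) hk
  have : σ * cα / c₂ * (c₂ * ‖x s‖ ^ 2) = σ * cα * ‖x s‖ ^ 2 := by
    have := D.pos₂.ne'; field_simp
  linarith [D.dissipation (x s) (x a - x s)]

theorem value_le_of_half_tauD_le (hx : IsSampledOn f x a b) (hb : b - a ≤ tauD Lf cα cγ c₂ σ r)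
    (ha : V (x a) ≤ V₀ * exp (-r * a)) (hs : s ∈ Icc a b)
    (hτ : tauD Lf cα cγ c₂ σ r / 2 ≤ s - a) :
    V (x s) ≤ exp (-(σ * cα / c₂) * (tauD Lf cα cγ c₂ σ r / 2)) * (V₀ * exp (-r * s)) := by
  have hV₀ : 0 ≤ V₀ := nonneg_of_mul_nonneg_left ((D.value_nonneg _).trans ha) (exp_pos _)
  set k := σ * cα / c₂
  have hk : 0 ≤ k := div_nonneg (mul_pos D.pos_σ D.pos_α).le D.pos₂.le
  calc V (x s) ≤ V (x a) * exp (-(r + k) * (s - a)) := D.value_le_mul_exp hx hb s hs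
    _ ≤ V₀ * exp (-r * a) * exp (-(r + k) * (s - a)) := by gcongr
    _ = exp (-k * (s - a)) * (V₀ * exp (-r * s)) := by
        rw [mul_assoc, ← exp_add, mul_left_comm, ← exp_add]; ring_nf
    _ ≤ _ := by gcongr ?_ * _; exact exp_le_exp.2 (by nlinarith)

theorem globalTrigger_le (hx : IsSampledOn f x a b) (hb : b - a ≤ tauD Lf cα cγ c₂ σ r)
    (hV : ∀ s ∈ Icc a b, V (x s) ≤ V₀ * exp (-r * s)) :
    ∀ s ∈ Icc a b, globalTrigger V cα cγ σ r cβ (x s) (x a - x s)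
      ≤ (cβ - margin Lf cα cγ c₂ σ r cβ) * (V₀ * exp (-r * s)) := by
  intro s hs
  have herror (θ : ℝ) (hθ : θ ∈ Icc 0 1) (hsτ : s - a ≤ θ * tauD Lf cα cγ c₂ σ r) :=
    D.globalTrigger_le_of_norm_error_sq_le (pow_le_one₀ hθ.1 hθ.2) (D.norm_error_sq_le hx hθ hs hsτ)
  set μ := margin Lf cα cγ c₂ σ r cβ
  have hVs := D.value_nonneg (x s)
  have hcβ := D.pos_β
  have hμ₁ : μ ≤ 3 * ((1 - σ) * cα - r * c₂) / (4 * c₂) := min_le_left _ _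
  have hμ₂ : μ ≤ cβ * (1 - exp (-(σ * cα / c₂) * (tauD Lf cα cγ c₂ σ r / 2))) := min_le_right _ _
  rcases le_total (s - a) (tauD Lf cα cγ c₂ σ r / 2) with hearly | hlate
  · have hμ_lt : μ < cβ := hμ₂.trans_lt (mul_lt_of_lt_one_right hcβ (sub_lt_self _ (exp_pos _)))
    calc globalTrigger V cα cγ σ r cβ (x s) (x a - x s)
        ≤ (cβ - (1 - (1 / 2) ^ 2) * ((1 - σ) * cα - r * c₂) / c₂) * V (x s) :=
          herror (1 / 2) (by norm_num) (by linarith)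
      _ ≤ (cβ - μ) * V (x s) := by
          gcongr
          exact hμ₁.trans_eq (by ring)
      _ ≤ (cβ - μ) * (V₀ * exp (-r * s)) := by
          have := sub_pos.2 hμ_lt
          gcongr
          exact hV s hs
  · have ha := hV a (left_mem_Icc.2 (hs.1.trans hs.2))
    calc globalTrigger V cα cγ σ r cβ (x s) (x a - x s)
        ≤ (cβ - (1 - 1 ^ 2) * ((1 - σ) * cα - r * c₂) / c₂) * V (x s) :=
          herror 1 (by norm_num) (by linarith [hs.2])
      _ = cβ * V (x s) := by ring
      _ ≤ cβ * (exp (-(σ * cα / c₂) * (tauD Lf cα cγ c₂ σ r / 2)) * (V₀ * exp (-r * s))) := by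
          gcongr
          exact D.value_le_of_half_tauD_le hx hb ha hs hlate
      _ ≤ (cβ - μ) * (V₀ * exp (-r * s)) := by
          rw [← mul_assoc]
          exact mul_le_mul_of_nonneg_right (by linarith) (hVs.trans (hV s hs))

end TriggerDesign

end Trigger

section Gain

variable {ι : Type*} [Fintype ι] [DecidableEq ι] (G : SimpleGraph ι) [DecidableRel G.Adj]
  {E : Type*} [NormedAddCommGroup E] [NormedSpace ℝ E]

/-- With consensus gain `ρ`, an estimate that follows the signal `h(x, e)` keeps its spread below
`ν γ(s)²`, `γ(s) = g e^{-rs}`, as long as the sampled trajectory satisfies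
`‖x‖² + ‖e‖² ≤ C γ(s)`. -/
def IsAdequateGain (f : E → E → E) (h : E × E → ι → ℝ) (C ν r ρ : ℝ) : Prop :=
  ∀ (x : ℝ → E) (y : ℝ → ι → ℝ) (a b g : ℝ), IsSampledOn f x a b →
    (∀ s ∈ Icc a b, ‖x s‖ ^ 2 + ‖x a - x s‖ ^ 2 ≤ C * (g * exp (-r * s))) →
    TracksOn G ρ (fun s => h (x s, x a - x s)) y (Icc a b) →
    spread (y a) ≤ ν * (g * exp (-r * a)) ^ 2 →
    ∀ s ∈ Icc a b, spread (y s) ≤ ν * (g * exp (-r * s)) ^ 2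

variable {G}

theorem HasLinearGrowthDeriv.exists_isAdequateGain (hG : G.Connected) {f : E → E → E}
    {h : E × E → ι → ℝ} (hh : HasLinearGrowthDeriv h) {Lf : ℝ}
    (hf : ∀ x e, ‖f x e‖ ≤ Lf * (‖x‖ + ‖e‖)) (C : ℝ) {ν r : ℝ} (hν : 0 < ν) (hr : 0 ≤ r) :
    ∃ ρ₀ > 0, ∀ ρ ≥ ρ₀, IsAdequateGain G f h C ν r ρ := by
  obtain ⟨A, hA, hderiv⟩ := hh.exists_norm_derivWithin_le hf
  have := hG.nonempty
  refine ⟨(1 + 2 * r + Fintype.card ι * (A * C) ^ 2 / ν) * (2 * Fintype.card ι ^ 3),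
    by positivity, fun ρ hρ x y a b g hx hC hy ha => ?_⟩
  refine hy.spread_le hG hν hr hρ (fun s hs => ?_) ha
  rw [mul_assoc]
  exact (hderiv x a b hx s hs).trans (mul_le_mul_of_nonneg_left (hC s hs) hA)

end Gain

section Network

variable {N : ℕ} {d : Fin N → ℕ} {V : Fin N → NetState d → ℝ}

theorem sum_Wxe (cα cγ σ r cβ : ℝ) (x e : NetState d) :
    ∑ i, Wxe V cα cγ σ r cβ x e i = globalTrigger (aggregate V) cα cγ σ r cβ x e := by
  simp only [Wxe, Wx, globalTrigger, aggregate, PiLp.norm_sq_eq_of_L2, Finset.sum_add_distrib,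
    Finset.mul_sum]

theorem Wxe_zero (cα cγ σ r cβ : ℝ) (x : NetState d) :
    Wxe V cα cγ σ r cβ x 0 = Wx V cα σ r cβ x := by
  ext i; simp [Wxe]

theorem hasLinearGrowthDeriv_Wx (hV : ∀ i, HasLinearGrowthDeriv (V i)) (cα σ r cβ : ℝ) :
    HasLinearGrowthDeriv (Wx V cα σ r cβ) :=
  hasLinearGrowthDeriv_pi fun i =>
    ((hasLinearGrowthDeriv_norm_sq.comp_continuousLinearMap
      (PiLp.proj 2 (𝕜 := ℝ) (fun i => EuclideanSpace ℝ (Fin (d i))) i)).const_smul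
        ((σ - 1) * cα)).add ((hV i).const_smul (r + cβ))

theorem hasLinearGrowthDeriv_Wxe (hV : ∀ i, HasLinearGrowthDeriv (V i)) (cα cγ σ r cβ : ℝ) :
    HasLinearGrowthDeriv fun p : NetState d × NetState d => Wxe V cα cγ σ r cβ p.1 p.2 :=
  ((hasLinearGrowthDeriv_Wx hV cα σ r cβ).comp_continuousLinearMap
    (ContinuousLinearMap.fst ℝ (NetState d) (NetState d))).add <|
  hasLinearGrowthDeriv_pi fun i =>
    (hasLinearGrowthDeriv_norm_sq.comp_continuousLinearMap
      ((PiLp.proj 2 (𝕜 := ℝ) (fun i => EuclideanSpace ℝ (Fin (d i))) i).comp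
        (ContinuousLinearMap.snd ℝ (NetState d) (NetState d)))).const_smul cγ

theorem differentiableOn_Wx (hV : ∀ i, Differentiable ℝ (V i)) (cα σ r cβ : ℝ)
    {x : ℝ → NetState d} {S : Set ℝ} (hx : DifferentiableOn ℝ x S) :
    DifferentiableOn ℝ (fun s => Wx V cα σ r cβ (x s)) S := by
  refine differentiableOn_pi.2 fun i => ?_
  have hxi : DifferentiableOn ℝ (fun s => x s i) S :=
    (PiLp.proj 2 (𝕜 := ℝ) (fun i => EuclideanSpace ℝ (Fin (d i))) i).differentiable
      |>.comp_differentiableOn hx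
  exact ((hxi.norm_sq ℝ).const_mul _).add (((hV i).comp_differentiableOn hx).const_mul _)

theorem differentiableOn_Wxe (hV : ∀ i, Differentiable ℝ (V i)) (cα cγ σ r cβ : ℝ)
    {x e : ℝ → NetState d} {S : Set ℝ} (hx : DifferentiableOn ℝ x S)
    (he : DifferentiableOn ℝ e S) :
    DifferentiableOn ℝ (fun s => Wxe V cα cγ σ r cβ (x s) (e s)) S := by
  refine differentiableOn_pi.2 fun i => ?_
  have hei : DifferentiableOn ℝ (fun s => e s i) S :=
    (PiLp.proj 2 (𝕜 := ℝ) (fun i => EuclideanSpace ℝ (Fin (d i))) i).differentiable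
      |>.comp_differentiableOn he
  exact (differentiableOn_pi.1 (differentiableOn_Wx hV cα σ r cβ hx) i).add
    ((hei.norm_sq ℝ).const_mul _)

variable (G : SimpleGraph (Fin N)) [DecidableRel G.Adj]

/-- A trigger design together with consensus gains that are high enough for it: the spread of both
estimates leaves room for the margin of the centralized trigger. -/
structure NetworkDesign (f : NetState d → NetState d → NetState d) (V : Fin N → NetState d → ℝ)
    (c₁ c₂ Lf cα cγ σ r cβ ρa ρz : ℝ) : Prop
    extends TriggerDesign f (aggregate V) c₁ c₂ Lf cα cγ σ r cβ where
  differentiable_apply : ∀ i, Differentiable ℝ (V i)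
  trigger_gain : IsAdequateGain G f (fun p => Wxe V cα cγ σ r cβ p.1 p.2) (1 / c₁ + cβ / cγ)
    ((margin Lf cα cγ c₂ σ r cβ / (2 * N)) ^ 2) r ρa
  estimate_gain : IsAdequateGain G f (fun p => Wx V cα σ r cβ p.1) (1 / c₁ + cβ / cγ)
    ((margin Lf cα cγ c₂ σ r cβ / (2 * N)) ^ 2) r ρz

/-- What the distributed trigger does on an interval `[a, b]` that starts at an update and contains
no other update in its interior; `α` is the estimate that is compared to the threshold. -/
structure Phase (f : NetState d → NetState d → NetState d) (V : Fin N → NetState d → ℝ)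
    (cα cγ σ r cβ ρa ρz V₀ a b : ℝ) (x : ℝ → NetState d) (z α : ℝ → Fin N → ℝ) : Prop where
  state : IsSampledOn f x a b
  estimate : TracksOn G ρz (fun s => Wx V cα σ r cβ (x s)) z (Icc a b)
  trigger : TracksOn G ρa (fun s => Wxe V cα cγ σ r cβ (x s) (x a - x s)) α (Icc a b)
  reset : α a = z a
  ne_threshold : ∀ s ∈ Ico a b, ∀ i, α s i ≠ cβ * V₀ * exp (-r * s) / N

/-- The properties of the state and of its estimate, at time `s`, that pass from one update to the
next: `V` is below the prescribed performance, the average of the estimates is right, and their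
spread, of which `ν` is the bound relative to the performance, is small. -/
structure Invariant (V : Fin N → NetState d → ℝ) (cα σ r cβ ν V₀ s : ℝ) (x : NetState d)
    (z : Fin N → ℝ) : Prop where
  value_le : aggregate V x ≤ V₀ * exp (-r * s)
  sum_eq : ∑ i, z i = ∑ i, Wx V cα σ r cβ x i
  spread_le : spread z ≤ ν * (V₀ * exp (-r * s)) ^ 2

namespace Phase

variable {G} {f : NetState d → NetState d → NetState d}
  {c₁ c₂ Lf cα cγ σ r cβ ρa ρz ν V₀ a b s : ℝ} {x : ℝ → NetState d} {z α : ℝ → Fin N → ℝ}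
  (P : Phase G f V cα cγ σ r cβ ρa ρz V₀ a b x z α)

include P

theorem sum_estimate (hV : ∀ i, Differentiable ℝ (V i))
    (ha : ∑ i, z a i = ∑ i, Wx V cα σ r cβ (x a) i) :
    ∀ s ∈ Icc a b, ∑ i, z s i = ∑ i, Wx V cα σ r cβ (x s) i :=
  P.estimate.sum_eq (differentiableOn_Wx hV cα σ r cβ P.state.differentiableOn) ha

theorem sum_trigger (hV : ∀ i, Differentiable ℝ (V i))
    (ha : ∑ i, z a i = ∑ i, Wx V cα σ r cβ (x a) i) :
    ∀ s ∈ Icc a b, ∑ i, α s i = globalTrigger (aggregate V) cα cγ σ r cβ (x s) (x a - x s) := by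
  intro s hs
  have hx := P.state.differentiableOn
  rw [← sum_Wxe]
  exact P.trigger.sum_eq (differentiableOn_Wxe hV cα cγ σ r cβ hx (hx.const_sub (x a)))
    (by rw [P.reset, ha, sub_self, Wxe_zero]) s hs

variable (D : NetworkDesign G f V c₁ c₂ Lf cα cγ σ r cβ ρa ρz) (hV₀ : 0 < V₀)
  (ha : Invariant V cα σ r cβ ((margin Lf cα cγ c₂ σ r cβ / (2 * N)) ^ 2) V₀ a (x a) (z a))

include D hV₀ ha

theorem trigger_lt_of_spread_le (hs : s ∈ Icc a b) (hτ : s - a ≤ tauD Lf cα cγ c₂ σ r)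
    (hvalue : ∀ u ∈ Icc a s, aggregate V (x u) ≤ V₀ * exp (-r * u))
    (hspread : spread (α s) ≤ (margin Lf cα cγ c₂ σ r cβ / (2 * N)) ^ 2 * (V₀ * exp (-r * s)) ^ 2)
    (i : Fin N) : α s i < cβ * V₀ * exp (-r * s) / N := by
  have hsum := P.sum_trigger D.differentiable_apply ha.sum_eq s hs
  have hlt := lt_div_card_of_sum_le_of_spread_le (c := cβ) (y := α s) D.margin_pos
    (mul_pos hV₀ (exp_pos (-r * s)))
    (hsum.trans_le (D.globalTrigger_le (P.state.mono_right hs.2) hτ hvalue s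
      (right_mem_Icc.2 hs.1))) (by simpa using hspread) i
  simpa [mul_assoc] using hlt

theorem trigger_le (hs : s ∈ Icc a b) (i : Fin N) : α s i ≤ cβ * V₀ * exp (-r * s) / N := by
  have hcont : ContinuousOn (fun s => α s i) (Icc a b) :=
    (continuous_apply i).comp_continuousOn P.trigger.continuousOn
  have hab : a ≤ b := hs.1.trans hs.2
  refine le_of_continuousOn_of_ne hcont (v := fun s => cβ * V₀ * exp (-r * s) / N)
    (by fun_prop) ?_ (fun s hs => P.ne_threshold s hs i) s hs
  refine P.trigger_lt_of_spread_le D hV₀ ha (left_mem_Icc.2 hab) (by simpa using D.tauD_pos.le)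
    (fun u hu => ?_) (P.reset ▸ ha.spread_le) i
  rw [Icc_self, mem_singleton_iff] at hu
  exact hu ▸ ha.value_le

theorem globalTrigger_le : ∀ s ∈ Icc a b,
    globalTrigger (aggregate V) cα cγ σ r cβ (x s) (x a - x s) ≤ cβ * (V₀ * exp (-r * s)) := by
  intro s hs
  have hcβ := D.pos_β
  calc globalTrigger (aggregate V) cα cγ σ r cβ (x s) (x a - x s) = ∑ i, α s i :=
        (P.sum_trigger D.differentiable_apply ha.sum_eq s hs).symm
    _ ≤ ∑ _i : Fin N, cβ * V₀ * exp (-r * s) / N :=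
        Finset.sum_le_sum fun i _ => P.trigger_le D hV₀ ha hs i
    _ = cβ * V₀ * exp (-r * s) * (N / N) := by simp; ring
    _ ≤ cβ * (V₀ * exp (-r * s)) := by
        rw [← mul_assoc]
        exact mul_le_of_le_one_right (by positivity) (div_self_le_one _)

theorem value_le : ∀ s ∈ Icc a b, aggregate V (x s) ≤ V₀ * exp (-r * s) :=
  D.value_le_of_globalTrigger_le P.state (P.globalTrigger_le D hV₀ ha) ha.value_le

theorem norm_sq_add_norm_sq_le : ∀ s ∈ Icc a b,
    ‖x s‖ ^ 2 + ‖x a - x s‖ ^ 2 ≤ (1 / c₁ + cβ / cγ) * (V₀ * exp (-r * s)) := fun s hs =>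
  D.norm_sq_add_norm_sq_le (P.globalTrigger_le D hV₀ ha s hs) (P.value_le D hV₀ ha s hs)

theorem invariant (hs : s ∈ Icc a b) :
    Invariant V cα σ r cβ ((margin Lf cα cγ c₂ σ r cβ / (2 * N)) ^ 2) V₀ s (x s) (z s) where
  value_le := P.value_le D hV₀ ha s hs
  sum_eq := P.sum_estimate D.differentiable_apply ha.sum_eq s hs
  spread_le := D.estimate_gain x z a b V₀ P.state (P.norm_sq_add_norm_sq_le D hV₀ ha) P.estimate
    ha.spread_le s hs

theorem trigger_lt (hs : s ∈ Icc a b) (hτ : s - a ≤ tauD Lf cα cγ c₂ σ r) (i : Fin N) :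
    α s i < cβ * V₀ * exp (-r * s) / N :=
  P.trigger_lt_of_spread_le D hV₀ ha hs hτ
    (fun u hu => P.value_le D hV₀ ha u (Icc_subset_Icc_right hs.2 hu))
    (D.trigger_gain x α a b V₀ P.state (P.norm_sq_add_norm_sq_le D hV₀ ha) P.trigger
      (P.reset ▸ ha.spread_le) s hs) i

end Phase

end Network

section TimeInterval

theorem toReal_le_of_le_coe {t : EReal} {s : ℝ} (ht : 0 ≤ t) (hs : t ≤ s) : t.toReal ≤ s :=
  EReal.coe_le_coe_iff.1 ((EReal.coe_toReal_le (EReal.bot_lt_zero.trans_le ht).ne').trans hs)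

theorem timeInterval_subset_Ici {t : ℕ → EReal} {k : ℕ} (ht : 0 ≤ t k) :
    timeInterval t k ⊆ Ici (t k).toReal := fun _ hs => toReal_le_of_le_coe ht hs.1

theorem coe_toReal_of_mem_timeInterval {t : ℕ → EReal} {k : ℕ} {s : ℝ} (ht : 0 ≤ t k)
    (hs : s ∈ timeInterval t k) : ((t k).toReal : EReal) = t k :=
  EReal.coe_toReal (hs.1.trans_lt (EReal.coe_lt_top s)).ne (EReal.bot_lt_zero.trans_le ht).ne'

theorem toReal_mem_timeInterval {t : ℕ → EReal} {k : ℕ} {s : ℝ} (ht : 0 ≤ t k)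
    (hs : s ∈ timeInterval t k) : (t k).toReal ∈ timeInterval t k := by
  have := coe_toReal_of_mem_timeInterval ht hs
  exact ⟨this.ge, this.le.trans (hs.1.trans hs.2)⟩

theorem exists_eqOn_timeInterval {S : Type*} [Nonempty S] {t : ℕ → EReal} (ht : Monotone t)
    {φ : ℕ → ℝ → S} (hφ : ∀ k (s : ℝ), (s : EReal) = t (k + 1) → φ k s = φ (k + 1) s) :
    ∃ y, ∀ k, EqOn y (φ k) (timeInterval t k) := by
  have agree {j k : ℕ} (hjk : j ≤ k) : EqOn (φ j) (φ k) (timeInterval t j ∩ timeInterval t k) := by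
    induction k, hjk using Nat.le_induction with
    | base => exact fun _ _ => rfl
    | succ k hjk ih =>
      rintro s ⟨hj, hk⟩
      have hs : (s : EReal) = t (k + 1) :=
        (hj.2.trans (ht (Nat.succ_le_succ hjk))).antisymm hk.1
      exact (ih ⟨hj, (ht k.le_succ).trans hs.ge, hs.le⟩).trans (hφ k s hs)
  have (s : ℝ) : ∃ v, ∀ k, s ∈ timeInterval t k → v = φ k s := by
    by_cases h : ∃ j, s ∈ timeInterval t j
    · obtain ⟨j, hj⟩ := h
      refine ⟨φ j s, fun k hk => ?_⟩
      rcases le_total j k with hjk | hkj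
      exacts [agree hjk ⟨hj, hk⟩, (agree hkj ⟨hk, hj⟩).symm]
    · exact ⟨Classical.arbitrary S, fun k hk => (h ⟨k, hk⟩).elim⟩
  choose y hy using this
  exact ⟨y, fun k s hs => hy s k hs⟩

end TimeInterval

section Hybrid

variable {S : Type*}

/-- A run from `p₀`, starting at time `0`, of the hybrid system with flows `Φ` and trigger sets `T`.
After the `k`-th update, at time `t` and in state `p` where `q k = (t, p)`, the system follows
`Φ (t, p)` until the first time in `T (t, p)`, which is the time of the next update. -/
structure HybridRun (Φ : EReal × S → ℝ → S) (T : EReal × S → Set ℝ) (p₀ : S) where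
  q : ℕ → EReal × S
  y : ℝ → S
  q_zero : q 0 = (0, p₀)
  time_mono : Monotone fun k => (q k).1
  eqOn_flow : ∀ k, EqOn y (Φ (q k)) (timeInterval (fun k => (q k).1) k)
  notMem_of_lt : ∀ k (s : ℝ), (s : EReal) < (q (k + 1)).1 → s ∉ T (q k)
  mem_of_eq : ∀ k (s : ℝ), (s : EReal) = (q (k + 1)).1 → s ∈ T (q k)

theorem mem_of_coe_eq_sInf_image {T : Set ℝ} (hT : IsClosed T) {s : ℝ}
    (hs : (s : EReal) = sInf ((↑) '' T)) : s ∈ T := by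
  have hne : T.Nonempty := nonempty_iff_ne_empty.2 fun h => by simp [h] at hs
  have hmem := hs ▸ sInf_mem_closure (hne.image ((↑) : ℝ → EReal))
  rw [← hT.closure_eq, EReal.isEmbedding_coe.closure_eq_preimage_closure_image]
  exact hmem

theorem nonempty_hybridRun {Φ : EReal × S → ℝ → S} {T : EReal × S → Set ℝ}
    (hΦ : ∀ q, Φ q q.1.toReal = q.2) (hle : ∀ q, ∀ s ∈ T q, q.1 ≤ (s : EReal))
    (hT : ∀ q, 0 ≤ q.1 → IsClosed (T q)) (p₀ : S) : Nonempty (HybridRun Φ T p₀) := by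
  let next (q : EReal × S) : EReal := sInf ((↑) '' T q)
  let q (k : ℕ) : EReal × S := (fun q => (next q, Φ q (next q).toReal))^[k] (0, p₀)
  have q_succ (k : ℕ) : q (k + 1) = (next (q k), Φ (q k) (next (q k)).toReal) :=
    iterate_succ_apply' _ _ _
  have time_mono : Monotone fun k => (q k).1 := monotone_nat_of_le_succ fun k => by
    rw [q_succ]
    exact le_sInf (forall_mem_image.2 fun s hs => hle (q k) s hs)
  have := Nonempty.intro p₀
  obtain ⟨y, hy⟩ := exists_eqOn_timeInterval time_mono (φ := fun k => Φ (q k)) fun k s hs => by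
    have hstart := hΦ (q (k + 1))
    rw [← hs, EReal.toReal_coe] at hstart
    rw [hstart, q_succ]
    rw [q_succ] at hs
    exact congrArg (Φ (q k)) (congrArg EReal.toReal hs)
  refine ⟨⟨q, y, rfl, time_mono, hy, fun k s hs hsT => ?_, fun k s hs => ?_⟩⟩
  · rw [q_succ] at hs
    exact hs.not_ge (sInf_le (mem_image_of_mem _ hsT))
  · rw [q_succ] at hs
    exact mem_of_coe_eq_sInf_image (hT (q k) (time_mono k.zero_le)) hs

theorem HybridRun.eq_of_coe_eq {Φ : EReal × S → ℝ → S} {T : EReal × S → Set ℝ} {p₀ : S}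
    (R : HybridRun Φ T p₀) (hΦ : ∀ q, Φ q q.1.toReal = q.2) {k : ℕ} {s : ℝ}
    (hs : (s : EReal) = (R.q k).1) : R.y s = (R.q k).2 := by
  rw [R.eqOn_flow k ⟨hs.ge, hs.le.trans (R.time_mono k.le_succ)⟩, ← hΦ (R.q k), ← hs,
    EReal.toReal_coe]

end Hybrid

section Existence

theorem lipschitzWith_sampled {E : Type*} [SeminormedAddCommGroup E] {f : E → E → E} {K : ℝ≥0}
    (hf : LipschitzWith K (uncurry f)) (p : E) : LipschitzWith K fun x => f x (p - x) :=
  LipschitzWith.of_dist_le_mul fun x y =>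
    (hf.dist_le_mul (x, p - x) (y, p - y)).trans_eq <| by
      rw [Prod.dist_eq, dist_sub_left, max_self]

variable {N m : ℕ} {d : Fin N → ℕ}

/-- The solution of the dynamics for all times from `a` on if no update occurs after `a`, where `p`
consists of the state and the estimate `z` at time `a`. -/
structure Continuation (G : SimpleGraph (Fin N)) [DecidableRel G.Adj]
    (f : NetState d → NetState d → NetState d) (V : Fin N → NetState d → ℝ)
    (cα cγ σ r cβ ρa ρz a : ℝ) (p : NetState d × (Fin N → ℝ)) where
  x : ℝ → NetState d
  z : ℝ → Fin N → ℝ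
  α : ℝ → Fin N → ℝ
  x_start : x a = p.1
  z_start : z a = p.2
  α_start : α a = p.2
  state : ∀ s ∈ Ici a, HasDerivWithinAt x (f (x s) (x a - x s)) (Ici a) s
  estimate : TracksOn G ρz (fun s => Wx V cα σ r cβ (x s)) z (Ici a)
  trigger : TracksOn G ρa (fun s => Wxe V cα cγ σ r cβ (x s) (x a - x s)) α (Ici a)

variable (G : SimpleGraph (Fin N)) [DecidableRel G.Adj]
  {f : NetState d → NetState d → NetState d} {V : Fin N → NetState d → ℝ}

theorem nonempty_continuation {K : ℝ≥0} (hf : LipschitzWith K (uncurry f))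
    (hV : ∀ i, Differentiable ℝ (V i)) (cα cγ σ r cβ ρa ρz a : ℝ)
    (p : NetState d × (Fin N → ℝ)) :
    Nonempty (Continuation G f V cα cγ σ r cβ ρa ρz a p) := by
  obtain ⟨x, hxa, hx⟩ := exists_isIntegralCurveOn_Ici_of_lipschitz
    (v := fun _ x => f x (p.1 - x))
    (fun _ => lipschitzWith_sampled hf p.1) (fun _ => continuous_const) a p.1
  rw [← hxa] at hx
  have hxd : DifferentiableOn ℝ x (Ici a) := fun s hs => (hx s hs).differentiableWithinAt
  obtain ⟨z, hza, hz⟩ := exists_tracksOn_Ici G ρz (differentiableOn_Wx hV cα σ r cβ hxd) p.2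
  obtain ⟨α, hαa, hα⟩ := exists_tracksOn_Ici G ρa
    (differentiableOn_Wxe hV cα cγ σ r cβ hxd (hxd.const_sub (x a))) p.2
  exact ⟨⟨x, z, α, hxa, hza, hαa, hx, hz, hα⟩⟩

variable {G}

namespace Continuation

variable {cα cγ σ r cβ ρa ρz : ℝ} {p : NetState d × (Fin N → ℝ)}

theorem isClosed_trigger_eq {t : EReal} (C : Continuation G f V cα cγ σ r cβ ρa ρz t.toReal p)
    (ht : 0 ≤ t) {θ : ℝ → ℝ} (hθ : Continuous θ) :
    IsClosed {s : ℝ | t ≤ s ∧ ∃ i, C.α s i = θ s} := by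
  have hclosed : IsClosed {s : ℝ | t ≤ s} := isClosed_Ici.preimage continuous_coe_real_ereal
  have hsub : {s : ℝ | t ≤ s} ⊆ Ici t.toReal := fun _ hs => toReal_le_of_le_coe ht hs
  rw [show {s : ℝ | t ≤ s ∧ ∃ i, C.α s i = θ s}
      = ⋃ i, {s : ℝ | t ≤ s} ∩ (fun s => C.α s i - θ s) ⁻¹' {0} by
    ext s; simp [sub_eq_zero]]
  refine isClosed_iUnion_of_finite fun i =>
    ContinuousOn.preimage_isClosed_of_isClosed ?_ hclosed isClosed_singleton
  exact ((continuous_apply i).comp_continuousOn (C.trigger.continuousOn.mono hsub)).sub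
    hθ.continuousOn

variable {t : ℕ → EReal} {k : ℕ} (C : Continuation G f V cα cγ σ r cβ ρa ρz (t k).toReal p)
  (ht : 0 ≤ t k) {x : ℝ → NetState d} (hx : EqOn x C.x (timeInterval t k))
include C ht hx

theorem hasDerivWithinAt_state : ∀ s ∈ timeInterval t k,
    HasDerivWithinAt x (f (x s) (x (t k).toReal - x s)) (timeInterval t k) s := fun s hs => by
  have hsub := timeInterval_subset_Ici (k := k) ht
  rw [hx hs, hx (toReal_mem_timeInterval ht hs)]
  exact ((C.state s (hsub hs)).mono hsub).congr hx (hx hs)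

theorem tracksOn_estimate (hV : ∀ i, Differentiable ℝ (V i)) {z : ℝ → Fin N → ℝ}
    (hz : EqOn z C.z (timeInterval t k)) :
    TracksOn G ρz (fun s => Wx V cα σ r cβ (x s)) z (timeInterval t k) := by
  have hxd : DifferentiableOn ℝ C.x (Ici (t k).toReal) := fun s hs =>
    (C.state s hs).differentiableWithinAt
  exact (C.estimate.mono (timeInterval_subset_Ici ht) (differentiableOn_Wx hV cα σ r cβ hxd)).congr
    (fun s hs => congrArg (Wx V cα σ r cβ) (hx hs)) hz

theorem tracksOn_trigger (hV : ∀ i, Differentiable ℝ (V i)) :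
    TracksOn G ρa (fun s => Wxe V cα cγ σ r cβ (x s) (x (t k).toReal - x s)) C.α
      (timeInterval t k) := by
  have hxd : DifferentiableOn ℝ C.x (Ici (t k).toReal) := fun s hs =>
    (C.state s hs).differentiableWithinAt
  refine (C.trigger.mono (timeInterval_subset_Ici ht)
    (differentiableOn_Wxe hV cα cγ σ r cβ hxd (hxd.const_sub _))).congr (fun s hs => ?_)
    fun _ _ => rfl
  simp only [hx hs, hx (toReal_mem_timeInterval ht hs)]

end Continuation

theorem nonempty_execution {F : NetState d → Input m → NetState d} {κ : NetState d → Input m}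
    {K : ℝ≥0} (hf : LipschitzWith K (uncurry (closedLoop F κ)))
    (hV : ∀ i, Differentiable ℝ (V i)) (cα cγ σ r cβ ρa ρz : ℝ) (x₀ : NetState d) :
    Nonempty (Execution G F κ V cα cγ σ r cβ ρa ρz x₀) := by
  let C (q : EReal × NetState d × (Fin N → ℝ)) :
      Continuation G (closedLoop F κ) V cα cγ σ r cβ ρa ρz q.1.toReal q.2 :=
    Classical.choice (nonempty_continuation G hf hV cα cγ σ r cβ ρa ρz q.1.toReal q.2)
  have C_start (q) : ((C q).x q.1.toReal, (C q).z q.1.toReal) = q.2 :=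
    Prod.ext (C q).x_start (C q).z_start
  obtain ⟨R⟩ := nonempty_hybridRun (Φ := fun q s => ((C q).x s, (C q).z s))
    (T := fun q => {s | q.1 ≤ s ∧ ∃ i, (C q).α s i = cβ * aggregate V x₀ * exp (-r * s) / N})
    C_start (fun q s hs => hs.1) (fun q hq => (C q).isClosed_trigger_eq hq (by fun_prop))
    (x₀, fun _ => (∑ j, Wx V cα σ r cβ x₀ j) / N)
  set t : ℕ → EReal := fun k => (R.q k).1
  have t_zero : t 0 = 0 := congrArg Prod.fst R.q_zero
  have t_nonneg (k : ℕ) : 0 ≤ t k := t_zero ▸ R.time_mono k.zero_le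
  have hx (k : ℕ) : EqOn (fun s => (R.y s).1) (C (R.q k)).x (timeInterval t k) := fun s hs =>
    congrArg Prod.fst (R.eqOn_flow k hs)
  have hz (k : ℕ) : EqOn (fun s => (R.y s).2) (C (R.q k)).z (timeInterval t k) := fun s hs =>
    congrArg Prod.snd (R.eqOn_flow k hs)
  have start : R.y 0 = (x₀, fun _ => (∑ j, Wx V cα σ r cβ x₀ j) / N) :=
    (R.eq_of_coe_eq C_start t_zero.symm).trans (congrArg Prod.snd R.q_zero)
  have jump (k : ℕ) (s : ℝ) (hs : (s : EReal) = t k) : (C (R.q k)).α s = (R.y s).2 := by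
    have hs' : s = (R.q k).1.toReal := congrArg EReal.toReal hs
    rw [R.eq_of_coe_eq C_start hs, ← (C (R.q k)).α_start, hs']
  exact ⟨{
    t := t
    x := fun s => (R.y s).1
    z := fun s => (R.y s).2
    a := fun k => (C (R.q k)).α
    t_zero := t_zero
    t_mono := R.time_mono
    x_zero := congrArg Prod.fst start
    x_ode := fun k => (C (R.q k)).hasDerivWithinAt_state (t_nonneg k) (hx k)
    z_zero := fun i => congrFun (congrArg Prod.snd start) i
    z_ode := fun k => (C (R.q k)).tracksOn_estimate (t_nonneg k) (hx k) hV (hz k)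
    a_jump := jump
    a_ode := fun k =>
      (C (R.q k)).tracksOn_trigger (t := t) (k := k) (t_nonneg k) (hx k) hV
    no_trigger_before := fun k s hs hlt i hi => R.notMem_of_lt k s hlt ⟨hs, i, hi⟩
    trigger_at := fun k s hs => (R.mem_of_eq k s hs).2 }⟩

end Existence

theorem exists_le_lt_succ_of_add_le_succ {t : ℕ → EReal} {τ s : ℝ} (ht₀ : t 0 = 0) (hτ : 0 < τ)
    (ht : ∀ k, t k + (τ : EReal) ≤ t (k + 1)) (hs : 0 ≤ s) :
    ∃ k, t k ≤ (s : EReal) ∧ (s : EReal) < t (k + 1) := by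
  by_contra! h
  have bounds (k : ℕ) : ((k * τ : ℝ) : EReal) ≤ t k ∧ t k ≤ s := by
    induction k with
    | zero => simpa [ht₀] using hs
    | succ k ih =>
      refine ⟨le_trans ?_ (ht k), h k ih.2⟩
      rw [Nat.cast_succ, add_one_mul, EReal.coe_add]
      exact add_le_add_left ih.1 _
  obtain ⟨n, hn⟩ := exists_nat_gt (s / τ)
  exact (EReal.coe_le_coe_iff.1 ((bounds n).1.trans (bounds n).2)).not_gt ((div_lt_iff₀ hτ).1 hn)

section Design

namespace TriggerDesign

variable {E : Type*} [NormedAddCommGroup E] [NormedSpace ℝ E] {f : E → E → E} {V : E → ℝ}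
  {c₁ c₂ Lf cα cγ σ r cβ : ℝ} (D : TriggerDesign f V c₁ c₂ Lf cα cγ σ r cβ)
include D

theorem value_pos {x : E} (hx : x ≠ 0) : 0 < V x :=
  (mul_pos D.pos₁ (by positivity)).trans_le (D.lower x)

theorem norm_le_of_value_le {s : ℝ} {x₀ x : E} (h : V x ≤ V x₀ * exp (-r * s)) :
    ‖x‖ ≤ √(c₂ / c₁) * ‖x₀‖ * exp (-(r / 2) * s) := by
  have hc₁ := D.pos₁
  have hc₂ := D.pos₂
  refine le_of_sq_le_sq ?_ (by positivity)
  calc ‖x‖ ^ 2 ≤ V x / c₁ := (le_div_iff₀' hc₁).2 (D.lower x)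
    _ ≤ c₂ * ‖x₀‖ ^ 2 * exp (-r * s) / c₁ := by
        gcongr
        exact h.trans (by gcongr; exact D.upper x₀)
    _ = (√(c₂ / c₁) * ‖x₀‖ * exp (-(r / 2) * s)) ^ 2 := by
        rw [mul_pow, mul_pow, sq_sqrt (by positivity), ← exp_nat_mul]
        push_cast
        ring_nf

end TriggerDesign

variable {N : ℕ} {d : Fin N → ℕ} {G : SimpleGraph (Fin N)} [DecidableRel G.Adj]
  {f : NetState d → NetState d → NetState d} {c₁ c₂ c₃ c₄ Lf cα cγ σ r cβ : ℝ}

theorem IsExpLyapunov.triggerDesign [Nontrivial (NetState d)] {V : NetState d → ℝ}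
    (hV : IsExpLyapunov f V c₁ c₂ c₃ c₄) (hd : Differentiable ℝ V)
    (R : AreRateConstants f V Lf cα cγ) (hr : 0 < r) (hσ : 0 < σ)
    (hslack : 0 < (1 - σ) * cα - r * c₂) (hcβ : (1 - σ) * (cα / c₁) - r < cβ) :
    TriggerDesign f V c₁ c₂ Lf cα cγ σ r cβ := by
  have equilibrium : f 0 0 = 0 := hV.apply_zero_zero hd
    (R.lipschitzWith_uncurry.continuous.uncurry_right 0).continuousAt
  have hc₁ := hV.pos₁
  obtain ⟨x, hx⟩ := exists_ne (0 : NetState d)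
  have c₁_le_c₂ : c₁ ≤ c₂ :=
    le_of_mul_le_mul_right ((hV.lower x).trans (hV.upper x)) (by positivity)
  have r_lt : r < (1 - σ) * (cα / c₁) := by
    rw [← mul_div_assoc, lt_div_iff₀ hc₁]
    exact (mul_le_mul_of_nonneg_left c₁_le_c₂ hr.le).trans_lt (sub_pos.1 hslack)
  exact ⟨hd, hV.lower, hV.upper, fun x e => by simpa [equilibrium] using R.lipschitz x e 0 0,
    R.dissipation, hc₁, hV.pos₂, R.pos_L, R.pos_α, R.pos_γ, hr, hσ, hslack, hcβ,
    (sub_pos.2 r_lt).trans hcβ⟩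

theorem TriggerDesign.exists_networkDesign (hG : G.Connected) {V : Fin N → NetState d → ℝ}
    (hV : ∀ i, HasLinearGrowthDeriv (V i))
    (D : TriggerDesign f (aggregate V) c₁ c₂ Lf cα cγ σ r cβ) :
    ∃ ρa₀ ρz₀ : ℝ, 0 < ρa₀ ∧ 0 < ρz₀ ∧ ∀ ρa ρz, ρa₀ ≤ ρa → ρz₀ ≤ ρz →
      NetworkDesign G f V c₁ c₂ Lf cα cγ σ r cβ ρa ρz := by
  have hN : (0 : ℝ) < N := Nat.cast_pos.2 (Fin.pos_iff_nonempty.2 hG.nonempty)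
  have hν : 0 < (margin Lf cα cγ c₂ σ r cβ / (2 * N)) ^ 2 := by
    have := D.margin_pos; positivity
  obtain ⟨ρa₀, hρa₀, ha⟩ := (hasLinearGrowthDeriv_Wxe hV cα cγ σ r cβ).exists_isAdequateGain hG
    D.norm_le (1 / c₁ + cβ / cγ) hν D.pos_r.le
  obtain ⟨ρz₀, hρz₀, hz⟩ := ((hasLinearGrowthDeriv_Wx hV cα σ r cβ).comp_continuousLinearMap
    (ContinuousLinearMap.fst ℝ (NetState d) (NetState d))).exists_isAdequateGain hG
    D.norm_le (1 / c₁ + cβ / cγ) hν D.pos_r.le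
  exact ⟨ρa₀, ρz₀, hρa₀, hρz₀, fun ρa ρz hρa hρz =>
    { D with
      differentiable_apply := fun i => (hV i).differentiable
      trigger_gain := ha ρa hρa
      estimate_gain := hz ρz hρz }⟩

end Design

section Performance

variable {N m : ℕ} {d : Fin N → ℕ} {G : SimpleGraph (Fin N)} [DecidableRel G.Adj]
  {F : NetState d → Input m → NetState d} {κ : NetState d → Input m}
  {V : Fin N → NetState d → ℝ} {c₁ c₂ Lf cα cγ σ r cβ ρa ρz : ℝ} {x₀ : NetState d}

namespace Execution

theorem t_nonneg (E : Execution G F κ V cα cγ σ r cβ ρa ρz x₀) (k : ℕ) : 0 ≤ E.t k :=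
  E.t_zero ▸ E.t_mono k.zero_le

theorem phase (E : Execution G F κ V cα cγ σ r cβ ρa ρz x₀) (hV : ∀ i, Differentiable ℝ (V i))
    {k : ℕ} {b : ℝ} (hb : b ∈ timeInterval E.t k) :
    Phase G (closedLoop F κ) V cα cγ σ r cβ ρa ρz (aggregate V x₀) (E.t k).toReal b
      E.x E.z (E.a k) := by
  have ha := coe_toReal_of_mem_timeInterval (E.t_nonneg k) hb
  have hsub : Icc (E.t k).toReal b ⊆ timeInterval E.t k := fun s hs =>
    ⟨ha.ge.trans (EReal.coe_le_coe_iff.2 hs.1), (EReal.coe_le_coe_iff.2 hs.2).trans hb.2⟩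
  have hx : DifferentiableOn ℝ E.x (timeInterval E.t k) := fun s hs =>
    (E.x_ode k s hs).differentiableWithinAt
  exact
    { state := fun s hs => (E.x_ode k s (hsub hs)).mono hsub
      estimate := TracksOn.mono (E.z_ode k) hsub (differentiableOn_Wx hV cα σ r cβ hx)
      trigger := TracksOn.mono (E.a_ode k) hsub
        (differentiableOn_Wxe hV cα cγ σ r cβ hx (hx.const_sub _))
      reset := E.a_jump k _ ha
      ne_threshold := fun s hs => E.no_trigger_before k s (hsub (Ico_subset_Icc_self hs)).1
        ((EReal.coe_lt_coe_iff.2 hs.2).trans_le hb.2) }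

theorem invariant_zero (E : Execution G F κ V cα cγ σ r cβ ρa ρz x₀) {ν : ℝ} (hν : 0 ≤ ν) :
    Invariant V cα σ r cβ ν (aggregate V x₀) 0 (E.x 0) (E.z 0) where
  value_le := by simp [E.x_zero]
  sum_eq := by
    rcases N.eq_zero_or_pos with rfl | hN
    · simp
    · simp only [E.z_zero, E.x_zero, Finset.sum_const, Finset.card_fin, nsmul_eq_mul]
      field_simp
  spread_le := by
    rw [funext E.z_zero, spread_const]
    positivity

theorem t_eq_zero (E : Execution G F κ V cα cγ σ r cβ ρa ρz 0) (hN : 0 < N)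
    (hV₀ : aggregate V 0 = 0) (k : ℕ) : E.t k = 0 := by
  induction k with
  | zero => exact E.t_zero
  | succ k ih =>
    refine le_antisymm (not_lt.1 fun h => ?_) (E.t_nonneg _)
    refine E.no_trigger_before k 0 (by simp [ih]) (by simpa using h) ⟨0, hN⟩ ?_
    have sum_Wx : ∑ j, Wx V cα σ r cβ 0 j = 0 := by
      simp [Wx, ← Finset.mul_sum, show ∑ j, V j 0 = 0 from hV₀]
    rw [E.a_jump k 0 (by simp [ih]), E.z_zero, sum_Wx, hV₀]
    simp

variable (E : Execution G F κ V cα cγ σ r cβ ρa ρz x₀)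
  (D : NetworkDesign G (closedLoop F κ) V c₁ c₂ Lf cα cγ σ r cβ ρa ρz)
  (hV₀ : 0 < aggregate V x₀) {k : ℕ} {s : ℝ}
include E D hV₀

theorem invariant_start (hs : s ∈ timeInterval E.t k) :
    Invariant V cα σ r cβ ((margin Lf cα cγ c₂ σ r cβ / (2 * N)) ^ 2) (aggregate V x₀)
      (E.t k).toReal (E.x (E.t k).toReal) (E.z (E.t k).toReal) := by
  induction k generalizing s with
  | zero => simpa only [E.t_zero, EReal.toReal_zero] using E.invariant_zero (sq_nonneg _)
  | succ k ih =>
    have hb := coe_toReal_of_mem_timeInterval (E.t_nonneg _) hs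
    have hmem : (E.t (k + 1)).toReal ∈ timeInterval E.t k :=
      ⟨(E.t_mono k.le_succ).trans hb.ge, hb.le⟩
    exact (E.phase D.differentiable_apply hmem).invariant D hV₀ (ih hmem)
      ⟨timeInterval_subset_Ici (E.t_nonneg k) hmem, le_rfl⟩

theorem value_le (hs : s ∈ timeInterval E.t k) :
    aggregate V (E.x s) ≤ aggregate V x₀ * exp (-r * s) :=
  (E.phase D.differentiable_apply hs).value_le D hV₀ (E.invariant_start D hV₀ hs) s
    ⟨timeInterval_subset_Ici (E.t_nonneg k) hs, le_rfl⟩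

theorem t_add_tauD_le (k : ℕ) : E.t k + (tauD Lf cα cγ c₂ σ r : ℝ) ≤ E.t (k + 1) := by
  by_contra! h
  have hb : ((E.t (k + 1)).toReal : EReal) = E.t (k + 1) :=
    EReal.coe_toReal h.ne_top (EReal.bot_lt_zero.trans_le (E.t_nonneg _)).ne'
  have hmem : (E.t (k + 1)).toReal ∈ timeInterval E.t k :=
    ⟨(E.t_mono k.le_succ).trans hb.ge, hb.le⟩
  rw [← hb, ← coe_toReal_of_mem_timeInterval (E.t_nonneg k) hmem, ← EReal.coe_add,
    EReal.coe_lt_coe_iff] at h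
  obtain ⟨i, hi⟩ := E.trigger_at k _ hb
  exact ((E.phase D.differentiable_apply hmem).trigger_lt D hV₀ (E.invariant_start D hV₀ hmem)
    ⟨timeInterval_subset_Ici (E.t_nonneg k) hmem, le_rfl⟩ (sub_le_iff_le_add'.2 h.le) i).ne hi

theorem exists_t_le_lt (hs : 0 ≤ s) : ∃ k, E.t k ≤ (s : EReal) ∧ (s : EReal) < E.t (k + 1) :=
  exists_le_lt_succ_of_add_le_succ E.t_zero D.tauD_pos (E.t_add_tauD_le D hV₀) hs

theorem value_le_of_nonneg (hs : 0 ≤ s) :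
    aggregate V (E.x s) ≤ aggregate V x₀ * exp (-r * s) := by
  obtain ⟨k, hk⟩ := E.exists_t_le_lt D hV₀ hs
  exact E.value_le D hV₀ ⟨hk.1, hk.2.le⟩

end Execution

theorem NetworkDesign.globallyExpStable
    (D : NetworkDesign G (closedLoop F κ) V c₁ c₂ Lf cα cγ σ r cβ ρa ρz) (hN : 0 < N) :
    GloballyExpStable G F κ V cα cγ σ r cβ ρa ρz := by
  refine ⟨norm_le_zero_iff.1 (by simpa using D.norm_le 0 0), √(c₂ / c₁), r / 2,
    sqrt_pos.2 (div_pos D.pos₂ D.pos₁), half_pos D.pos_r, fun x₀ E k s hs => ?_⟩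
  rcases eq_or_ne x₀ 0 with rfl | hx₀
  · have hV₀ : aggregate V 0 = 0 :=
      le_antisymm (by simpa using D.upper 0) (by simpa using D.lower 0)
    have hs₀ : (s : EReal) = 0 := le_antisymm (E.t_eq_zero hN hV₀ (k + 1) ▸ hs.2)
      (E.t_eq_zero hN hV₀ k ▸ hs.1)
    simp [EReal.coe_eq_zero.1 hs₀, E.x_zero]
  · exact D.norm_le_of_value_le (E.value_le D (D.value_pos hx₀) hs)

theorem globallyExpStable_of_subsingleton [Subsingleton (NetState d)] :
    GloballyExpStable G F κ V cα cγ σ r cβ ρa ρz :=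
  ⟨Subsingleton.elim _ _, 1, 1, one_pos, one_pos, fun x₀ E k s _ => by
    rw [Subsingleton.elim (E.x s) 0, norm_zero]
    positivity⟩

end Performance

theorem mainTheorem1_general {N m : ℕ} {d : Fin N → ℕ}
    (G : SimpleGraph (Fin N)) [DecidableRel G.Adj] (hG : G.Connected)
    (F : NetState d → Input m → NetState d) (κ : NetState d → Input m)
    (V : Fin N → NetState d → ℝ) (c₁ c₂ c₃ c₄ : ℝ)
    (hF : ∃ K, LipschitzWith K (fun p : NetState d × Input m => F p.1 p.2))
    (hκ : ∃ K, LipschitzWith K κ)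
    (hVderiv : ∀ i, HasLinearGrowthDeriv (V i))
    (hV : IsExpLyapunov (closedLoop F κ) (aggregate V) c₁ c₂ c₃ c₄) :
    (∃ Lf cα cγ : ℝ, AreRateConstants (closedLoop F κ) (aggregate V) Lf cα cγ) ∧
    ∀ Lf cα cγ : ℝ, AreRateConstants (closedLoop F κ) (aggregate V) Lf cα cγ →
    ∀ r σ cβ : ℝ, 0 < r → 0 < σ → σ < 1 - r * c₂ / cα → (1 - σ) * (cα / c₁) - r < cβ →
      0 < tauD Lf cα cγ c₂ σ r ∧
      ∃ ρa₀ ρz₀ : ℝ, 0 < ρa₀ ∧ 0 < ρz₀ ∧ ∀ ρa ρz : ℝ, ρa₀ ≤ ρa → ρz₀ ≤ ρz →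
        (∀ x₀ : NetState d, Nonempty (Execution G F κ V cα cγ σ r cβ ρa ρz x₀)) ∧
        (∀ x₀ : NetState d, x₀ ≠ 0 → ∀ E : Execution G F κ V cα cγ σ r cβ ρa ρz x₀,
          (∀ k, E.t k + (tauD Lf cα cγ c₂ σ r : ℝ) ≤ E.t (k + 1)) ∧
          (∀ s : ℝ, 0 ≤ s → ∃ k, E.t k ≤ (s : EReal) ∧ (s : EReal) < E.t (k + 1)) ∧
          (∀ s : ℝ, 0 ≤ s → aggregate V (E.x s) ≤ aggregate V x₀ * exp (-r * s))) ∧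
        GloballyExpStable G F κ V cα cγ σ r cβ ρa ρz := by
  have hd (i : Fin N) : Differentiable ℝ (V i) := (hVderiv i).differentiable
  have hdV : Differentiable ℝ (aggregate V) := Differentiable.fun_sum fun i _ => hd i
  refine ⟨?_, fun Lf cα cγ R r σ cβ hr hσ hσr hcβ => ?_⟩
  · obtain ⟨Lf, hLf, hf⟩ := exists_lipschitz_closedLoop hF hκ
    exact ⟨Lf, hV.exists_areRateConstants hLf hf⟩
  have hf := R.lipschitzWith_uncurry
  have hslack : 0 < (1 - σ) * cα - r * c₂ :=
    sub_pos.2 ((div_lt_iff₀ R.pos_α).1 (lt_sub_comm.1 hσr))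
  refine ⟨tauD_pos R.pos_L R.pos_γ hslack, ?_⟩
  rcases subsingleton_or_nontrivial (NetState d) with _ | _
  · exact ⟨1, 1, one_pos, one_pos, fun ρa ρz _ _ => ⟨nonempty_execution hf hd cα cγ σ r cβ ρa ρz,
      fun x₀ hx₀ => (hx₀ (Subsingleton.elim _ _)).elim, globallyExpStable_of_subsingleton⟩⟩
  obtain ⟨ρa₀, ρz₀, hρa₀, hρz₀, hρ⟩ :=
    (hV.triggerDesign hdV R hr hσ hslack hcβ).exists_networkDesign hG hVderiv
  refine ⟨ρa₀, ρz₀, hρa₀, hρz₀, fun ρa ρz hρa hρz => ?_⟩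
  have D := hρ ρa ρz hρa hρz
  exact ⟨nonempty_execution hf hd cα cγ σ r cβ ρa ρz, fun x₀ hx₀ E =>
    have hV₀ := D.value_pos hx₀
    ⟨E.t_add_tauD_le D hV₀, fun _ => E.exists_t_le_lt D hV₀, fun _ => E.value_le_of_nonneg D hV₀⟩,
    D.globallyExpStable (Fin.pos_iff_nonempty.2 hG.nonempty)⟩

end DistributedETC

open DistributedETC in
theorem mainTheorem1 {N m : ℕ} {d : Fin N → ℕ}
    (G : SimpleGraph (Fin N)) [DecidableRel G.Adj] (hG : G.Connected)
    (F : NetState d → Input m → NetState d) (κ : NetState d → Input m)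
    (V : Fin N → NetState d → ℝ) (c₁ c₂ c₃ c₄ : ℝ)
    (hF : ∃ K, LipschitzWith K (fun p : NetState d × Input m => F p.1 p.2))
    (hκ : ∃ K, LipschitzWith K κ)
    (hVlocal : ∀ i, IsLocalAt G i (V i))
    (hVdiff : ∀ i, ContDiff ℝ 1 (V i))
    (hVgrad : ∀ i, ∃ K, LipschitzWith K (fderiv ℝ (V i)))
    (hVcrit : ∀ i, fderiv ℝ (V i) 0 = 0)
    (hV : IsExpLyapunov (closedLoop F κ) (aggregate V) c₁ c₂ c₃ c₄) :
    (∃ Lf cα cγ : ℝ, AreRateConstants (closedLoop F κ) (aggregate V) Lf cα cγ) ∧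
    ∀ Lf cα cγ : ℝ, AreRateConstants (closedLoop F κ) (aggregate V) Lf cα cγ →
    ∀ r σ cβ : ℝ, 0 < r → r < cα / c₂ → 0 < σ → σ < 1 - r * c₂ / cα →
      (1 - σ) * (cα / c₁) - r < cβ →
      0 < tauD Lf cα cγ c₂ σ r ∧
      ∃ ρa₀ ρz₀ : ℝ, 0 < ρa₀ ∧ 0 < ρz₀ ∧ ∀ ρa ρz : ℝ, ρa₀ ≤ ρa → ρz₀ ≤ ρz →
        (∀ x₀ : NetState d, Nonempty (Execution G F κ V cα cγ σ r cβ ρa ρz x₀)) ∧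
        (∀ x₀ : NetState d, x₀ ≠ 0 → ∀ E : Execution G F κ V cα cγ σ r cβ ρa ρz x₀,
          (∀ k, E.t k + (tauD Lf cα cγ c₂ σ r : ℝ) ≤ E.t (k + 1)) ∧
          (∀ s : ℝ, 0 ≤ s → ∃ k, E.t k ≤ (s : EReal) ∧ (s : EReal) < E.t (k + 1)) ∧
          (∀ s : ℝ, 0 ≤ s → aggregate V (E.x s) ≤ aggregate V x₀ * Real.exp (-r * s))) ∧
        GloballyExpStable G F κ V cα cγ σ r cβ ρa ρz := by
  have general := mainTheorem1_general G hG F κ V c₁ c₂ c₃ c₄ hF hκ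
    (fun i => hasLinearGrowthDeriv_of_lipschitz_fderiv ((hVdiff i).differentiable one_ne_zero)
      (hVgrad i).choose_spec (hVcrit i)) hV
  exact ⟨general.1, fun Lf cα cγ R r σ cβ hr _ => general.2 Lf cα cγ R r σ cβ hr⟩
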